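/- A weighted graph is a (finite or infinite) vertex set $V$ with a symmetric function $w:V\times V\to[0,\infty)$ such that $w_x:=\sum_y w(x,y)<\infty$ for every vertex $x$; its edges are the pairs with $w(x,y)>0$, $\mathrm{dist}$ is the graph distance ($\infty$ if there is no path), and $w_z:=\sum_{x\in z}w_x$ for a vertex set $z$. The random walk moves from $x$ to $y$ with probability $w(x,y)/w_x$, and $T_{oz}\in\{0,1,2,\dots\}\cup\{\infty\}$ is the first time that the walk started at $o$ at time $0$ visits $z$. Let $c>0$ and $p>-2$. For $n\ge 1$ let $\mathcal G_n$ be the class of all weighted graphs $G$ with vertices $o$, $z$ such that $w_o>0$, $\mathrm{dist}(o,z)\ge n$ and $w_z/w_o<c\,n^p$. Then, as $n\to\infty$, $$\inf_{\mathcal G_n}\mathbf E\,T_{oz}\ \sim\ \frac{2n^2}{(p+2)\log n},$$ and, for every $0<\alpha<2/(p+2)$, $$\sup_{\mathcal G_n}\mathbf P\Big[T_{oz}<\frac{\alpha n^2}{\log n}\Big]\ =\ n^{-(\alpha(p+2)-2)^2/(8\alpha)+o(1)},$$ where the $o(1)$ depends only on $n,\alpha,c,p$ and tends to $0$ as $n\to\infty$.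 Both statements also hold when $z$ is allowed to be an arbitrary vertex set instead of a single vertex. -/

import Mathlib

open MeasureTheory ProbabilityTheory Filter Topology Asymptotics
open scoped NNReal ENNReal

universe u

/-- A weighted graph on the vertex set `V`: a symmetric nonnegative function on `V × V` whose
vertex weights `∑ y, w x y` are all finite, so that the random walk makes sense. Loops are
allowed, and `V` may be infinite. -/
structure WeightedGraph (V : Type u) where
  w : V → V → ℝ≥0
  symm : ∀ x y, w x y = w y x
  tsum_ne_top : ∀ x, ∑' y, (w x y : ℝ≥0∞) ≠ ⊤

namespace WeightedGraph

noncomputable section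

variable {V : Type u} (G : WeightedGraph V)

/-- The weight `w_x` of a vertex: the sum of the weights of the edges at `x`. -/
def vertexWeight (x : V) : ℝ≥0∞ := ∑' y, (G.w x y : ℝ≥0∞)

/-- The weight `w_z` of a vertex set: the sum of the weights of its vertices. -/
def setWeight (z : Set V) : ℝ≥0∞ := ∑' x : z, G.vertexWeight x

/-- The graph whose edges are the support of `w` (loops do not matter for distances). -/
def support : SimpleGraph V where
  Adj x y := x ≠ y ∧ G.w x y ≠ 0
  symm := ⟨fun x y h => ⟨h.1.symm, by rw [G.symm y x]; exact h.2⟩⟩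
  loopless := ⟨fun _ h => h.1 rfl⟩

/-- The graph distance from a vertex to a vertex set, `⊤` if the set cannot be reached. -/
def distTo (o : V) (z : Set V) : ℕ∞ := ⨅ x ∈ z, G.support.edist o x

open scoped Classical in
/-- The law of one step of the walk from `x`: it moves to `y` with probability `w x y / w_x`.
(At an isolated vertex, which a walk started elsewhere never visits, the walk stays put.) -/
def step (x : V) : PMF V :=
  if h : ∑' y, (G.w x y : ℝ≥0∞) = 0 then PMF.pure x
  else PMF.normalize (fun y => (G.w x y : ℝ≥0∞)) h (G.tsum_ne_top x)

variable [MeasurableSpace V] [DiscreteMeasurableSpace V]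

/-- The transition kernel of the random walk. -/
def stepKernel : Kernel V V where
  toFun x := (G.step x).toMeasure
  measurable' := Measurable.of_discrete

instance : IsMarkovKernel G.stepKernel :=
  ⟨fun x => by change IsProbabilityMeasure (G.step x).toMeasure; infer_instance⟩

/-- The transition kernel, as a kernel from the past `X 0, …, X n` to the next position. -/
def pastKernel (n : ℕ) : Kernel (Finset.Iic n → V) V :=
  G.stepKernel.comap (fun h => h ⟨n, Finset.mem_Iic.2 le_rfl⟩) (measurable_pi_apply _)

instance (n : ℕ) : IsMarkovKernel (G.pastKernel n) := by
  unfold pastKernel; infer_instance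

/-- The law, on the space of trajectories, of the random walk started at `o` at time `0`. -/
def walkLaw (o : V) : Measure (ℕ → V) :=
  Kernel.traj (X := fun _ => V) G.pastKernel 0 (fun _ => o)

/-- The first time at which a trajectory is in `z`, `⊤` if there is none. -/
def hitTime {V : Type u} (z : Set V) (ω : ℕ → V) : ℝ≥0∞ := ⨅ (k : ℕ) (_ : ω k ∈ z), (k : ℝ≥0∞)

/-- The expectation of the hitting time `T_{oz}`. -/
def expectedHit (o : V) (z : Set V) : ℝ≥0∞ := ∫⁻ ω, hitTime z ω ∂(G.walkLaw o)

/-- The probability that `T_{oz} < t`. -/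
def probHitBefore (o : V) (z : Set V) (t : ℝ) : ℝ≥0∞ :=
  G.walkLaw o {ω | hitTime z ω < ENNReal.ofReal t}

/-- The constraints `n ≤ dist(o, z)` and `w_z / w_o < c n ^ p` (with `w_o > 0`). -/
structure IsAdmissible {V : Type u} (G : WeightedGraph V) (c p : ℝ) (n : ℕ) (o : V) (z : Set V) :
    Prop where
  pos : 0 < G.vertexWeight o
  le_dist : (n : ℕ∞) ≤ G.distTo o z
  weight_lt : G.setWeight z / G.vertexWeight o < ENNReal.ofReal (c * (n : ℝ) ^ p)

end

end WeightedGraph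

noncomputable section

/-- The infimum of `E T_{oz}` over admissible weighted graphs with vertices `o`, `z`. (The
`σ`-algebra on the vertex set is always the one of all subsets.) -/
def infExpectedHit (c p : ℝ) (n : ℕ) : ℝ≥0∞ :=
  ⨅ (V : Type u) (_ : MeasurableSpace V) (_ : DiscreteMeasurableSpace V) (G : WeightedGraph V)
    (o : V) (z : V) (_ : G.IsAdmissible c p n o {z}), G.expectedHit o {z}

/-- The infimum of `E T_{oz}` over admissible weighted graphs with a vertex `o` and a vertex
set `z`. -/
def infExpectedHitSet (c p : ℝ) (n : ℕ) : ℝ≥0∞ :=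
  ⨅ (V : Type u) (_ : MeasurableSpace V) (_ : DiscreteMeasurableSpace V) (G : WeightedGraph V)
    (o : V) (z : Set V) (_ : G.IsAdmissible c p n o z), G.expectedHit o z

/-- The supremum of `P[T_{oz} < t]` over admissible weighted graphs with vertices `o`, `z`. -/
def supProbHit (c p : ℝ) (n : ℕ) (t : ℝ) : ℝ≥0∞ :=
  ⨆ (V : Type u) (_ : MeasurableSpace V) (_ : DiscreteMeasurableSpace V) (G : WeightedGraph V)
    (o : V) (z : V) (_ : G.IsAdmissible c p n o {z}), G.probHitBefore o {z} t

/-- The supremum of `P[T_{oz} < t]` over admissible weighted graphs with a vertex `o` and a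
vertex set `z`. -/
def supProbHitSet (c p : ℝ) (n : ℕ) (t : ℝ) : ℝ≥0∞ :=
  ⨆ (V : Type u) (_ : MeasurableSpace V) (_ : DiscreteMeasurableSpace V) (G : WeightedGraph V)
    (o : V) (z : Set V) (_ : G.IsAdmissible c p n o z), G.probHitBefore o z t

end

/-! Upper bound on speed. Fix `m = exp l > 1`. On a finite network let `h` and `k` be the discounted
hitting functions `E m^(-T)` of `z` and of `o`. Since both have the same eigenvalue `m` of the
transition operator, the current `w x y * (h y * k x - h x * k y)` is a flow from `o` to `z`; let
`J` be its strength. Summing `log h` by parts against this flow shows that the entropies `∑ w h(y)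
log (h(y)/h(x))`, weighted by `k(x)`, add up to `J * -log h(o)`; likewise with `h` and `k`
exchanged. A Pinsker inequality bounds each entropy from below, and the product of the two bounds at
a vertex dominates `log m / 2` times the square of the absolute flow through that vertex
(`flow_le_entropy`). The flow has to cover the distance `d`, so Cauchy-Schwarz gives `2 l d^2 ≤ (1 -
log h(o)) (1 - log k(z))` (`rate_mul_rate_ge`). Reversibility gives `log h(o) ≤ log k(z) + L` with
`L = log (R m / (m - 1))`, where `R` bounds `w_z / w_o`. Solving the resulting quadratic inequality
yields the universal bound `laplace_le`. Arbitrary graphs are reached by killing the walk outside a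
finite set and collapsing `z` to a point.

Take `R = c n^p`, `l = ℓ (log n / n)^2` and `q = (p + 2) / 2`. Then `L ~ (p + 2) log n`, and the
Laplace transform is at most `n^(q - √(q^2 + 2ℓ) + o(1))`. The exponential Chebyshev inequality with
the best `ℓ` gives the exponent of the large deviations; Markov's inequality then gives the lower
bound on the expectation.

Sharpness. On a path with edge weights `ρ^i` the drift is `(ρ - 1)/(ρ + 1)`. The weight constraint
alone would allow `ρ - 1` to be only about `p log n / n`. A loop of weight `n / log^2 n` at `o` and
a last edge weaker by the factor `log^2 n / n` improve `p` to `p + 2`, up to powers of `log n`, and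
delay the walk by only `O(n^2 / log^3 n)`. Supersolutions bound its expected hitting time and
subsolutions bound its Laplace transform from below. Because this lower bound matches the universal
upper bound at every `ℓ`, comparing three nearby values of `ℓ` (a Gärtner-Ellis argument) gives the
lower bound on the probability. -/

/-! ### A Pinsker-type entropy inequality. -/

theorem le_log_of_pos {u : ℝ} (hu : 0 < u) :
    (u - 1) * (5 * u + 1) / (2 * u * (u + 2)) ≤ Real.log u := by
  -- The rational function agrees with `log` to third order at `1`, so the derivative of the
  -- difference is a multiple of `(x - 1)^3` and changes sign only at the minimum `x = 1`.
  have hderiv : ∀ x : ℝ, 0 < x → HasDerivAt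
      (fun x : ℝ => Real.log x - (x - 1) * (5 * x + 1) / (2 * x * (x + 2)))
      ((x - 1) ^ 3 / (x ^ 2 * (x + 2) ^ 2)) x := by
    intro x hx
    have h1 : HasDerivAt (fun x : ℝ => (x - 1) * (5 * x + 1))
        (1 * (5 * x + 1) + (x - 1) * (5 * 1)) x :=
      ((hasDerivAt_id x).sub_const 1).mul (((hasDerivAt_id x).const_mul 5).add_const 1)
    have h2 : HasDerivAt (fun x : ℝ => 2 * x * (x + 2)) ((2 * 1) * (x + 2) + 2 * x * 1) x :=
      ((hasDerivAt_id x).const_mul 2).mul ((hasDerivAt_id x).add_const 2)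
    have h3 := (Real.hasDerivAt_log hx.ne').sub (h1.div h2 (by positivity))
    refine HasDerivAt.congr_deriv h3 ?_
    field_simp
    ring
  set g : ℝ → ℝ := fun x => Real.log x - (x - 1) * (5 * x + 1) / (2 * x * (x + 2)) with hg
  have h1 : g 1 = 0 := by simp [hg]
  suffices 0 ≤ g u by simpa [hg] using this
  rw [← h1]
  rcases le_total u 1 with h | h
  · have : AntitoneOn g (Set.Ioc 0 1) := by
      apply antitoneOn_of_deriv_nonpos (convex_Ioc 0 1)
      · exact fun x hx => (hderiv x hx.1).continuousAt.continuousWithinAt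
      · intro x hx
        rw [interior_Ioc] at hx
        exact (hderiv x hx.1).differentiableAt.differentiableWithinAt
      · intro x hx
        rw [interior_Ioc] at hx
        rw [(hderiv x hx.1).deriv]
        apply div_nonpos_of_nonpos_of_nonneg _ (by positivity)
        have : 0 ≤ (1 - x) ^ 3 := pow_nonneg (by linarith [hx.2]) 3
        nlinarith
    exact this ⟨hu, h⟩ ⟨one_pos, le_rfl⟩ h
  · have : MonotoneOn g (Set.Ici 1) := by
      apply monotoneOn_of_deriv_nonneg (convex_Ici 1)
      · exact fun x hx =>
          (hderiv x (lt_of_lt_of_le one_pos hx)).continuousAt.continuousWithinAt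
      · intro x hx
        rw [interior_Ici] at hx
        exact (hderiv x (lt_trans one_pos hx)).differentiableAt.differentiableWithinAt
      · intro x hx
        rw [interior_Ici] at hx
        have hx' : (1 : ℝ) < x := hx
        rw [(hderiv x (lt_trans one_pos hx)).deriv]
        exact div_nonneg (pow_nonneg (by linarith) 3) (by positivity)
    exact this (Set.mem_Ici.2 le_rfl) h h

theorem mul_log_ge {u : ℝ} (hu : 0 ≤ u) :
    u - 1 + 3 * (u - 1) ^ 2 / (2 * (u + 2)) ≤ u * Real.log u := by
  rcases hu.eq_or_lt with rfl | hu
  · norm_num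
  · have h := mul_le_mul_of_nonneg_left (le_log_of_pos hu) hu.le
    refine le_trans (le_of_eq ?_) h
    field_simp
    ring

/-- A form of Pinsker's inequality: a bound for `∑ w h log (h / a)` where `∑ w h = m a ∑ w`. -/
theorem pinsker_sum {ι : Type*} [Fintype ι] (w h : ι → ℝ) (hw : ∀ y, 0 ≤ w y) (hh : ∀ y, 0 ≤ h y)
    {a m : ℝ} (ha : 0 < a) (hm : 0 < m) (hW : 0 < ∑ y, w y)
    (hmean : ∑ y, w y * h y = m * (∑ y, w y) * a) :
    m * Real.log m * ((∑ y, w y) * a) +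
        (∑ y, w y * |h y - m * a|) ^ 2 / (2 * m * ((∑ y, w y) * a)) ≤
      ∑ y, w y * h y * (Real.log (h y) - Real.log a) := by
  set W := ∑ y, w y with hWdef
  have hma : 0 < m * a := mul_pos hm ha
  -- This is `mul_log_ge` at `u = h y / (m * a)`; the case `h y = 0` is separate because the
  -- logarithm of the quotient does not split there.
  have key : ∀ y, w y * (Real.log m * h y + (h y - m * a)) +
      w y * (3 / 2 * ((h y - m * a) ^ 2 / (h y + 2 * (m * a)))) ≤
      w y * h y * (Real.log (h y) - Real.log a) := by
    intro y
    rcases (hh y).eq_or_lt with h0 | h0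
    · rw [← h0, ← mul_add]
      have e : 3 / 2 * ((0 - m * a) ^ 2 / (0 + 2 * (m * a))) = 3 / 4 * (m * a) := by
        field_simp; ring
      rw [e]
      nlinarith [mul_nonneg (hw y) hma.le]
    · have h1 := mul_log_ge (u := h y / (m * a)) (by positivity)
      rw [Real.log_div h0.ne' hma.ne', Real.log_mul hm.ne' ha.ne'] at h1
      have h2 := mul_le_mul_of_nonneg_left h1 (mul_nonneg (hw y) hma.le)
      have e1 : w y * (m * a) * (h y / (m * a) * (Real.log (h y) - (Real.log m + Real.log a)))
          = w y * h y * (Real.log (h y) - Real.log a) - w y * (Real.log m * h y) := by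
        field_simp; ring
      have e2 : w y * (m * a) * (h y / (m * a) - 1 +
          3 * (h y / (m * a) - 1) ^ 2 / (2 * (h y / (m * a) + 2))) = w y * (h y - m * a) +
          w y * (3 / 2 * ((h y - m * a) ^ 2 / (h y + 2 * (m * a)))) := by
        field_simp
      rw [e1, e2] at h2
      linarith
  have hsum := Finset.sum_le_sum fun y (_ : y ∈ Finset.univ) => key y
  have e1 : ∑ y, w y * (Real.log m * h y + (h y - m * a)) = m * Real.log m * (W * a) := by
    have : ∀ y, w y * (Real.log m * h y + (h y - m * a)) =
        (Real.log m + 1) * (w y * h y) - (m * a) * w y := fun y => by ring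
    simp only [this, Finset.sum_sub_distrib, ← Finset.mul_sum, hmean, ← hWdef]
    ring
  rw [Finset.sum_add_distrib, e1] at hsum
  refine le_trans ?_ hsum
  gcongr
  -- The denominators `h y + 2 m a` have mean `3 m a`, and this 3 cancels against the factor `3 / 2`
  -- to leave Pinsker's constant `1 / 2`.
  have cs := Finset.sum_sq_le_sum_mul_sum_of_sq_le_mul Finset.univ
    (r := fun y => w y * |h y - m * a|)
    (f := fun y => w y * ((h y - m * a) ^ 2 / (h y + 2 * (m * a))))
    (g := fun y => w y * (h y + 2 * (m * a)))
    (fun y _ => mul_nonneg (hw y) (div_nonneg (sq_nonneg _) (by linarith [hh y])))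
    (fun y _ => mul_nonneg (hw y) (by linarith [hh y]))
    (fun y _ => by
      have : h y + 2 * (m * a) ≠ 0 := by linarith [hh y]
      have e := div_mul_cancel₀ ((h y - m * a) ^ 2) this
      rw [mul_pow, sq_abs]
      exact le_of_eq (by linear_combination (-(w y) ^ 2) * e))
  have e2 : ∑ y, w y * (h y + 2 * (m * a)) = 3 * (m * (W * a)) := by
    simp only [mul_add, Finset.sum_add_distrib, hmean, ← Finset.sum_mul, ← hWdef]
    ring
  rw [e2] at cs
  have hpos : 0 < m * (W * a) := by positivity
  have e3 : ∑ y, w y * (3 / 2 * ((h y - m * a) ^ 2 / (h y + 2 * (m * a)))) =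
      3 / 2 * ∑ y, w y * ((h y - m * a) ^ 2 / (h y + 2 * (m * a))) := by
    rw [Finset.mul_sum]
    exact Finset.sum_congr rfl fun y _ => by ring
  rw [e3, mul_assoc 2 m, div_le_iff₀ (by positivity)]
  nlinarith

/-! ### Discounted hitting functions and entropy on finite networks. -/

section Network

set_option linter.unusedSectionVars false

variable {ι : Type*} [Fintype ι] [DecidableEq ι]

theorem sum_antisymm_eq_zero {θ : ι → ι → ℝ} (hθ : ∀ x y, θ x y = -θ y x) :
    ∑ x, ∑ y, θ x y = 0 := by
  have h : ∑ x, ∑ y, θ x y = -∑ x, ∑ y, θ x y := by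
    calc ∑ x, ∑ y, θ x y = ∑ y, ∑ x, θ x y := Finset.sum_comm
      _ = ∑ y, ∑ x, -θ y x := by simp_rw [← hθ]
      _ = _ := by simp
  linarith

/-- Summation by parts for a flow `θ` from `o` to `z`. -/
theorem flow_sum_by_parts {θ : ι → ι → ℝ} (hθ : ∀ x y, θ x y = -θ y x) {o z : ι} (hoz : o ≠ z)
    (hdiv : ∀ x, x ≠ o → x ≠ z → ∑ y, θ x y = 0) (f : ι → ℝ) :
    ∑ x, ∑ y, θ x y * (f x - f y) = 2 * ((∑ y, θ o y) * (f o - f z)) := by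
  have hred : ∀ g : ι → ℝ, ∑ x, g x * ∑ y, θ x y = g o * ∑ y, θ o y + g z * ∑ y, θ z y := by
    intro g
    rw [← Finset.sum_pair hoz (f := fun x => g x * ∑ y, θ x y)]
    symm
    apply Finset.sum_subset (Finset.subset_univ _)
    intro x _ hx
    simp only [Finset.mem_insert, Finset.mem_singleton, not_or] at hx
    rw [hdiv x hx.1 hx.2, mul_zero]
  have hz : ∑ y, θ z y = -∑ y, θ o y := by
    have h := hred 1
    simp only [Pi.one_apply, one_mul, sum_antisymm_eq_zero hθ] at h
    linarith
  have h1 : ∑ x, ∑ y, θ x y * f x = (∑ y, θ o y) * (f o - f z) := by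
    rw [show ∑ x, ∑ y, θ x y * f x = ∑ x, f x * ∑ y, θ x y from
      Finset.sum_congr rfl fun x _ => by rw [← Finset.sum_mul, mul_comm], hred f, hz]
    ring
  have h2 : ∑ x, ∑ y, θ x y * f y = -∑ x, ∑ y, θ x y * f x := by
    rw [Finset.sum_comm, ← Finset.sum_neg_distrib]
    refine Finset.sum_congr rfl fun y _ => ?_
    rw [← Finset.sum_neg_distrib]
    refine Finset.sum_congr rfl fun x _ => ?_
    rw [hθ x y]
    ring
  simp_rw [mul_sub, Finset.sum_sub_distrib]
  rw [h2, h1]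
  ring

/-- A finite network with a discounted hitting function of a vertex `z`: `h z = 1` and, away from
`z`, the mean of `h` over the neighbours of `x` is `m * h x`. -/
structure IsDiscounted (w : ι → ι → ℝ) (m : ℝ) (z : ι) (h : ι → ℝ) : Prop where
  nonneg : ∀ x, 0 ≤ h x
  le_one : ∀ x, h x ≤ 1
  target : h z = 1
  mean : ∀ x, x ≠ z → ∑ y, w x y * h y = m * (∑ y, w x y) * h x

/-- Discounting by `m⁻¹ < 1` makes the transition operator a sup-norm contraction, with a Banach
fixed point; the bounds 0 and 1 come from the minimum and maximum principles. A vertex of weight 0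
gets a zero row, so row sums are only at most 1. -/
theorem exists_isDiscounted (w : ι → ι → ℝ) (hw : ∀ x y, 0 ≤ w x y) {m : ℝ} (hm : 1 < m) (z : ι) :
    ∃ h, IsDiscounted w m z h := by
  have hm0 : 0 < m := one_pos.trans hm
  have hinv : m⁻¹ < 1 := inv_lt_one_of_one_lt₀ hm
  let P : ι → ι → ℝ := fun x y => w x y / ∑ u, w x u
  have hP : ∀ x y, 0 ≤ P x y := fun x y =>
    div_nonneg (hw x y) (Finset.sum_nonneg fun u _ => hw x u)
  have hP1 : ∀ x, ∑ y, P x y ≤ 1 := fun x => by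
    simp only [P, ← Finset.sum_div]
    exact div_self_le_one _
  let Ψ : (ι → ℝ) → ι → ℝ := fun h x => if x = z then 1 else m⁻¹ * ∑ y, P x y * h y
  have hcoe : ((Real.toNNReal m⁻¹ : NNReal) : ℝ) = m⁻¹ := Real.coe_toNNReal _ (by positivity)
  have hΨ : ContractingWith (Real.toNNReal m⁻¹) Ψ := by
    refine ⟨by rw [← NNReal.coe_lt_coe, hcoe]; exact hinv,
      LipschitzWith.of_dist_le_mul fun f g => ?_⟩
    rw [hcoe]
    refine (dist_pi_le_iff (by positivity)).2 fun x => ?_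
    by_cases hx : x = z
    · simp only [Ψ, hx, if_true, dist_self]
      positivity
    · simp only [Ψ, hx, if_false, Real.dist_eq, ← mul_sub, ← Finset.sum_sub_distrib, abs_mul,
        abs_of_pos (inv_pos.2 hm0)]
      gcongr
      calc |∑ y, P x y * (f y - g y)| ≤ ∑ y, |P x y * (f y - g y)| :=
            Finset.abs_sum_le_sum_abs _ _
        _ ≤ ∑ y, P x y * dist f g := by
            refine Finset.sum_le_sum fun y _ => ?_
            rw [abs_mul, abs_of_nonneg (hP x y)]
            exact mul_le_mul_of_nonneg_left (dist_le_pi_dist f g y) (hP x y)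
        _ ≤ dist f g := by
            rw [← Finset.sum_mul]
            exact mul_le_of_le_one_left dist_nonneg (hP1 x)
  have hfix : Ψ (hΨ.fixedPoint) = hΨ.fixedPoint := hΨ.fixedPoint_isFixedPt
  set h := hΨ.fixedPoint with hh
  have htarget : h z = 1 := by rw [← hfix]; simp [Ψ]
  have heq : ∀ x, x ≠ z → h x = m⁻¹ * ∑ y, P x y * h y := fun x hx => by
    conv_lhs => rw [← hfix]
    simp [Ψ, hx]
  have : Nonempty ι := ⟨z⟩
  have hnn : ∀ x, 0 ≤ h x := by
    obtain ⟨x₀, hx₀⟩ := Finite.exists_min h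
    intro x
    refine le_trans ?_ (hx₀ x)
    by_contra! hneg
    have hxz : x₀ ≠ z := by rintro rfl; rw [htarget] at hneg; linarith
    have h1 : h x₀ ≤ ∑ y, P x₀ y * h y := by
      calc h x₀ ≤ (∑ y, P x₀ y) * h x₀ := by nlinarith [hP1 x₀]
        _ ≤ _ := by
          rw [Finset.sum_mul]
          exact Finset.sum_le_sum fun y _ => mul_le_mul_of_nonneg_left (hx₀ y) (hP _ _)
    have h2 := heq x₀ hxz
    have h3 := mul_le_mul_of_nonneg_left h1 (inv_pos.2 hm0).le
    rw [← h2] at h3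
    nlinarith
  have hle : ∀ x, h x ≤ 1 := by
    obtain ⟨x₀, hx₀⟩ := Finite.exists_max h
    intro x
    refine (hx₀ x).trans ?_
    by_contra! hgt
    have hxz : x₀ ≠ z := by rintro rfl; rw [htarget] at hgt; linarith
    have h1 : ∑ y, P x₀ y * h y ≤ h x₀ := by
      calc _ ≤ (∑ y, P x₀ y) * h x₀ := by
            rw [Finset.sum_mul]
            exact Finset.sum_le_sum fun y _ => mul_le_mul_of_nonneg_left (hx₀ y) (hP _ _)
        _ ≤ h x₀ := by nlinarith [hP1 x₀]
    have h2 := heq x₀ hxz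
    have h3 := mul_le_mul_of_nonneg_left h1 (inv_pos.2 hm0).le
    rw [← h2] at h3
    nlinarith
  refine ⟨h, hnn, hle, htarget, fun x hx => ?_⟩
  rw [heq x hx]
  by_cases hW : ∑ u, w x u = 0
  · have : ∀ y, w x y = 0 := fun y =>
      (Finset.sum_eq_zero_iff_of_nonneg fun u _ => hw x u).1 hW y (Finset.mem_univ _)
    simp [this]
  · simp only [P, div_mul_eq_mul_div, ← Finset.sum_div]
    field_simp

variable {w : ι → ι → ℝ} {m : ℝ} {o z : ι} {h k : ι → ℝ}

/-- The discounted current between two discounted hitting functions. -/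
def discountedFlow (w : ι → ι → ℝ) (h k : ι → ℝ) (x y : ι) : ℝ := w x y * (h y * k x - h x * k y)

theorem discountedFlow_antisymm (hsymm : ∀ x y, w x y = w y x) (x y : ι) :
    discountedFlow w h k x y = -discountedFlow w h k y x := by
  simp only [discountedFlow, hsymm x y]; ring

theorem sum_discountedFlow (w : ι → ι → ℝ) (h k : ι → ℝ) (x : ι) :
    ∑ y, discountedFlow w h k x y = k x * ∑ y, w x y * h y - h x * ∑ y, w x y * k y := by
  simp only [discountedFlow, Finset.mul_sum, ← Finset.sum_sub_distrib]
  exact Finset.sum_congr rfl fun y _ => by ring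

/-- Both functions have the same factor `m`, so the two terms cancel. -/
theorem IsDiscounted.sum_flow_eq_zero (hh : IsDiscounted w m z h) (hk : IsDiscounted w m o k)
    (x : ι) (hxo : x ≠ o) (hxz : x ≠ z) : ∑ y, discountedFlow w h k x y = 0 := by
  rw [sum_discountedFlow, hh.mean x hxz, hk.mean x hxo]; ring

theorem IsDiscounted.sum_mul_le (hk : IsDiscounted w m o k) (hw : ∀ x y, 0 ≤ w x y) (x : ι) :
    ∑ y, w x y * k y ≤ ∑ y, w x y :=
  Finset.sum_le_sum fun y _ => mul_le_of_le_one_right (hw x y) (hk.le_one y)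

theorem IsDiscounted.flow_at_source (hh : IsDiscounted w m z h) (hk : IsDiscounted w m o k)
    (hoz : o ≠ z) : ∑ y, discountedFlow w h k o y =
      h o * (m * (∑ y, w o y) - ∑ y, w o y * k y) := by
  rw [sum_discountedFlow, hh.mean o hoz, hk.target]; ring

theorem IsDiscounted.flow_at_target (hh : IsDiscounted w m z h) (hk : IsDiscounted w m o k)
    (hsymm : ∀ x y, w x y = w y x) (hoz : o ≠ z) : ∑ y, discountedFlow w h k o y =
      k z * (m * (∑ y, w z y) - ∑ y, w z y * h y) := by
  have h1 := sum_antisymm_eq_zero (discountedFlow_antisymm (h := h) (k := k) hsymm)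
  have h2 : ∑ x, ∑ y, discountedFlow w h k x y = ∑ y, discountedFlow w h k o y +
      ∑ y, discountedFlow w h k z y := by
    rw [← Finset.sum_pair hoz (f := fun x => ∑ y, discountedFlow w h k x y)]
    symm
    apply Finset.sum_subset (Finset.subset_univ _)
    intro x _ hx
    simp only [Finset.mem_insert, Finset.mem_singleton, not_or] at hx
    exact hh.sum_flow_eq_zero hk x hx.1 hx.2
  rw [h1, sum_discountedFlow w h k z, hk.mean z hoz.symm, hh.target] at h2
  linarith

/-- Reversibility: comparison of the discounted hitting functions in the two directions. -/
theorem IsDiscounted.reverse_bound (hh : IsDiscounted w m z h) (hk : IsDiscounted w m o k)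
    (hsymm : ∀ x y, w x y = w y x) (hw : ∀ x y, 0 ≤ w x y) (hoz : o ≠ z) :
    h o * (m - 1) * ∑ y, w o y ≤ k z * m * ∑ y, w z y := by
  have h1 := hh.flow_at_source hk hoz
  rw [hh.flow_at_target hk hsymm hoz] at h1
  have h2 : h o * (m * (∑ y, w o y) - ∑ y, w o y) ≤
      h o * (m * (∑ y, w o y) - ∑ y, w o y * k y) := by
    have := hk.sum_mul_le hw o
    exact mul_le_mul_of_nonneg_left (by linarith) (hh.nonneg o)
  have h3 : k z * (m * (∑ y, w z y) - ∑ y, w z y * h y) ≤ k z * (m * (∑ y, w z y)) := by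
    refine mul_le_mul_of_nonneg_left ?_ (hk.nonneg z)
    have : 0 ≤ ∑ y, w z y * h y :=
      Finset.sum_nonneg fun y _ => mul_nonneg (hw z y) (hh.nonneg y)
    linarith
  calc h o * (m - 1) * ∑ y, w o y = h o * (m * (∑ y, w o y) - ∑ y, w o y) := by ring
    _ ≤ k z * (m * ∑ y, w z y) := by linarith
    _ = _ := by ring

/-- The entropy production at a vertex. -/
noncomputable def entropyAt (w : ι → ι → ℝ) (h : ι → ℝ) (x : ι) : ℝ :=
  ∑ y, w x y * h y * (Real.log (h y) - Real.log (h x))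

theorem IsDiscounted.entropyAt_ge (hh : IsDiscounted w m z h) (hw : ∀ x y, 0 ≤ w x y) (hm : 1 < m)
    {x : ι} (hx : x ≠ z) (hhx : 0 < h x) (hW : 0 < ∑ y, w x y) :
    m * Real.log m * ((∑ y, w x y) * h x) +
        (∑ y, w x y * |h y - m * h x|) ^ 2 / (2 * m * ((∑ y, w x y) * h x)) ≤
      entropyAt w h x :=
  pinsker_sum (w x) h (hw x) hh.nonneg hhx (one_pos.trans hm) hW (hh.mean x hx)

theorem IsDiscounted.mul_eq_zero_of_zero (hh : IsDiscounted w m z h) (hw : ∀ x y, 0 ≤ w x y)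
    {x : ι} (hx : x ≠ z) (h0 : h x = 0 ∨ ∑ y, w x y = 0) (y : ι) : w x y * h y = 0 := by
  have : ∑ y, w x y * h y = 0 := by
    rw [hh.mean x hx]; rcases h0 with h0 | h0 <;> simp [h0]
  exact (Finset.sum_eq_zero_iff_of_nonneg fun y _ => mul_nonneg (hw x y) (hh.nonneg y)).1 this y
    (Finset.mem_univ _)

/-- Where `h x` or the weight of `x` vanishes, every product `w x y * h y` vanishes too, so the
value `log 0 = 0` does no harm. -/
theorem IsDiscounted.entropyAt_nonneg (hh : IsDiscounted w m z h) (hw : ∀ x y, 0 ≤ w x y)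
    (hm : 1 < m) {x : ι} (hx : x ≠ z) : 0 ≤ entropyAt w h x := by
  by_cases h0 : h x = 0 ∨ ∑ y, w x y = 0
  · have := hh.mul_eq_zero_of_zero hw hx h0
    simp [entropyAt, this]
  · push Not at h0
    have h1 : 0 < h x := (hh.nonneg x).lt_of_ne' h0.1
    have h2 : 0 < ∑ y, w x y := (Finset.sum_nonneg fun y _ => hw x y).lt_of_ne' h0.2
    refine le_trans ?_ (hh.entropyAt_ge hw hm hx h1 h2)
    have := Real.log_pos hm
    positivity

/-- Summation by parts for the potential `-log h`, which vanishes at `z`. The two halves of the flow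
give the same sum by the symmetry of `w`. No positivity of `h` is needed, as the identity holds for
any potential. -/
theorem IsDiscounted.sum_mul_entropyAt (hh : IsDiscounted w m z h) (hk : IsDiscounted w m o k)
    (hsymm : ∀ x y, w x y = w y x) (hoz : o ≠ z) :
    ∑ x, k x * entropyAt w h x = (∑ y, discountedFlow w h k o y) * -Real.log (h o) := by
  have h0 := flow_sum_by_parts (discountedFlow_antisymm (h := h) (k := k) hsymm) hoz
    (hh.sum_flow_eq_zero hk) (fun x => -Real.log (h x))
  rw [hh.target, Real.log_one, neg_zero, sub_zero] at h0
  have h1 : ∑ x, ∑ y, discountedFlow w h k x y * (-Real.log (h x) - -Real.log (h y)) =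
      ∑ x, k x * entropyAt w h x + ∑ x, k x * entropyAt w h x := by
    have e : ∑ x, k x * entropyAt w h x =
        ∑ x, ∑ y, w x y * h x * k y * (Real.log (h x) - Real.log (h y)) := by
      rw [Finset.sum_comm]
      refine Finset.sum_congr rfl fun x _ => ?_
      rw [entropyAt, Finset.mul_sum]
      refine Finset.sum_congr rfl fun y _ => ?_
      rw [hsymm x y]; ring
    nth_rewrite 2 [e]
    rw [← Finset.sum_add_distrib]
    refine Finset.sum_congr rfl fun x _ => ?_
    rw [entropyAt, Finset.mul_sum, ← Finset.sum_add_distrib]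
    refine Finset.sum_congr rfl fun y _ => ?_
    rw [discountedFlow]; ring
  linarith

/-- The term at `o` is nonnegative. At `z` the mean property fails, but `u - 1 ≤ u log u` shows that
the entropy term there is at least `-J`, which costs the `+ 1`. -/
theorem IsDiscounted.sum_erase_entropyAt_le (hh : IsDiscounted w m z h) (hk : IsDiscounted w m o k)
    (hsymm : ∀ x y, w x y = w y x) (hw : ∀ x y, 0 ≤ w x y) (hm : 1 < m) (hoz : o ≠ z) :
    ∑ x ∈ {x | x ≠ o ∧ x ≠ z}, k x * entropyAt w h x ≤
      (∑ y, discountedFlow w h k o y) * (-Real.log (h o) + 1) := by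
  have h1 := hh.sum_mul_entropyAt hk hsymm hoz
  have h2 := Finset.sum_filter_add_sum_filter_not Finset.univ (fun x => x ≠ o ∧ x ≠ z)
    (fun x => k x * entropyAt w h x)
  have h3 : (Finset.univ.filter fun x => ¬(x ≠ o ∧ x ≠ z)) = {o, z} := by
    ext x; simp only [Finset.mem_filter, Finset.mem_univ, true_and, Finset.mem_insert,
      Finset.mem_singleton]; tauto
  rw [h3, Finset.sum_pair hoz, h1] at h2
  have h4 : 0 ≤ k o * entropyAt w h o :=
    mul_nonneg (hk.nonneg o) (hh.entropyAt_nonneg hw hm hoz)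
  have h5 : ∑ y, w z y * h y - ∑ y, w z y ≤ entropyAt w h z := by
    rw [entropyAt, ← Finset.sum_sub_distrib, hh.target, Real.log_one]
    refine Finset.sum_le_sum fun y _ => ?_
    have := mul_log_ge (hh.nonneg y)
    have h6 : h y - 1 ≤ h y * Real.log (h y) := by
      refine le_trans ?_ this
      have : 0 ≤ 3 * (h y - 1) ^ 2 / (2 * (h y + 2)) := by
        have := hh.nonneg y
        positivity
      linarith
    nlinarith [hw z y, mul_le_mul_of_nonneg_left h6 (hw z y)]
  have h6 := hh.flow_at_target hk hsymm hoz
  have h7 : -(∑ y, discountedFlow w h k o y) ≤ k z * entropyAt w h z := by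
    rw [h6, ← mul_neg]
    refine mul_le_mul_of_nonneg_left (le_trans ?_ h5) (hk.nonneg z)
    have : 0 ≤ ∑ y, w z y := Finset.sum_nonneg fun y _ => hw z y
    nlinarith
  linarith

theorem IsDiscounted.sum_flow_swap (hh : IsDiscounted w m z h) (hk : IsDiscounted w m o k)
    (hsymm : ∀ x y, w x y = w y x) (hoz : o ≠ z) :
    ∑ y, discountedFlow w k h z y = ∑ y, discountedFlow w h k o y := by
  rw [hh.flow_at_target hk hsymm hoz, hk.flow_at_source hh hoz.symm]

/-- Subtracting the means `m h x` and `m k x` leaves the flow unchanged, so its absolute sum is at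
most `a + b`, where `a` and `b` are the deviations appearing in the two Pinsker bounds. -/
theorem IsDiscounted.flow_le_entropy (hh : IsDiscounted w m z h) (hk : IsDiscounted w m o k)
    (hw : ∀ x y, 0 ≤ w x y) (hm : 1 < m) {x : ι} (hxo : x ≠ o) (hxz : x ≠ z) :
    Real.sqrt (Real.log m / 2) * ∑ y, |discountedFlow w h k x y| ≤
      Real.sqrt (k x * entropyAt w h x) * Real.sqrt (h x * entropyAt w k x) := by
  by_cases h0 : h x = 0 ∨ k x = 0 ∨ ∑ y, w x y = 0
  · have : ∀ y, discountedFlow w h k x y = 0 := by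
      intro y
      have e : discountedFlow w h k x y = k x * (w x y * h y) - h x * (w x y * k y) := by
        rw [discountedFlow]; ring
      rcases h0 with h0 | h0 | h0
      · rw [e, hh.mul_eq_zero_of_zero hw hxz (Or.inl h0), h0]; ring
      · rw [e, hk.mul_eq_zero_of_zero hw hxo (Or.inl h0), h0]; ring
      · rw [e, hk.mul_eq_zero_of_zero hw hxo (Or.inr h0),
          hh.mul_eq_zero_of_zero hw hxz (Or.inr h0)]; ring
    simp only [this, abs_zero, Finset.sum_const_zero, mul_zero]
    positivity
  · push Not at h0
    have h1 : 0 < h x := (hh.nonneg x).lt_of_ne' h0.1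
    have h2 : 0 < k x := (hk.nonneg x).lt_of_ne' h0.2.1
    have h3 : 0 < ∑ y, w x y := (Finset.sum_nonneg fun y _ => hw x y).lt_of_ne' h0.2.2
    have hl := Real.log_pos hm
    have hm0 : 0 < m := one_pos.trans hm
    have hR := mul_le_mul_of_nonneg_left (hh.entropyAt_ge hw hm hxz h1 h3) h2.le
    have hS := mul_le_mul_of_nonneg_left (hk.entropyAt_ge hw hm hxo h2 h3) h1.le
    set W := ∑ y, w x y
    set R := ∑ y, w x y * |h y - m * h x|
    set S := ∑ y, w x y * |k y - m * k x|
    have hR0 : 0 ≤ R := Finset.sum_nonneg fun y _ => mul_nonneg (hw x y) (abs_nonneg _)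
    have hS0 : 0 ≤ S := Finset.sum_nonneg fun y _ => mul_nonneg (hw x y) (abs_nonneg _)
    have hΘ : ∑ y, |discountedFlow w h k x y| ≤ k x * R + h x * S := by
      rw [Finset.mul_sum, Finset.mul_sum, ← Finset.sum_add_distrib]
      refine Finset.sum_le_sum fun y _ => ?_
      have e : discountedFlow w h k x y =
          w x y * (k x * (h y - m * h x) - h x * (k y - m * k x)) := by
        rw [discountedFlow]; ring
      rw [e, abs_mul, abs_of_nonneg (hw x y)]
      calc w x y * |k x * (h y - m * h x) - h x * (k y - m * k x)|
          ≤ w x y * (|k x * (h y - m * h x)| + |h x * (k y - m * k x)|) :=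
            mul_le_mul_of_nonneg_left (abs_sub _ _) (hw x y)
        _ = _ := by rw [abs_mul, abs_mul, abs_of_pos h1, abs_of_pos h2]; ring
    have hN : 0 < m * (W * h x * k x) := by positivity
    have hR' : Real.log m * (m * (W * h x * k x)) + (k x * R) ^ 2 / (2 * (m * (W * h x * k x))) ≤
        k x * entropyAt w h x := by
      refine le_trans (le_of_eq ?_) hR
      field_simp
    have hS' : Real.log m * (m * (W * h x * k x)) + (h x * S) ^ 2 / (2 * (m * (W * h x * k x))) ≤
        h x * entropyAt w k x := by
      refine le_trans (le_of_eq ?_) hS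
      field_simp
    set N := m * (W * h x * k x)
    set a := k x * R
    set b := h x * S
    have ha : 0 ≤ a := mul_nonneg h2.le hR0
    have hb : 0 ≤ b := mul_nonneg h1.le hS0
    have hl1 : 0 ≤ Real.log m * N + a ^ 2 / (2 * N) := by positivity
    have hl2 : 0 ≤ Real.log m * N + b ^ 2 / (2 * N) := by positivity
    -- The difference of the two sides is a perfect square; this is why the mean term and the
    -- deviation term of the Pinsker bound are both kept.
    have hprod : Real.log m / 2 * (a + b) ^ 2 ≤
        (Real.log m * N + a ^ 2 / (2 * N)) * (Real.log m * N + b ^ 2 / (2 * N)) := by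
      have e : (Real.log m * N + a ^ 2 / (2 * N)) * (Real.log m * N + b ^ 2 / (2 * N)) -
          Real.log m / 2 * (a + b) ^ 2 = (Real.log m * N - a * b / (2 * N)) ^ 2 := by
        field_simp; ring
      nlinarith [sq_nonneg (Real.log m * N - a * b / (2 * N))]
    calc Real.sqrt (Real.log m / 2) * ∑ y, |discountedFlow w h k x y|
        ≤ Real.sqrt (Real.log m / 2) * (a + b) :=
          mul_le_mul_of_nonneg_left hΘ (Real.sqrt_nonneg _)
      _ = Real.sqrt (Real.log m / 2 * (a + b) ^ 2) := by
          rw [Real.sqrt_mul (by positivity), Real.sqrt_sq (by positivity)]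
      _ ≤ Real.sqrt ((k x * entropyAt w h x) * (h x * entropyAt w k x)) :=
          Real.sqrt_le_sqrt (hprod.trans (mul_le_mul hR' hS' hl2 (hl1.trans hR')))
      _ = _ := Real.sqrt_mul (hl1.trans hR') _

/-- The product of the exponential rates of the discounted hitting functions in the two directions
is at least `2 log m` times the square of the distance. -/
theorem IsDiscounted.rate_mul_rate_ge (hh : IsDiscounted w m z h) (hk : IsDiscounted w m o k)
    (hsymm : ∀ x y, w x y = w y x) (hw : ∀ x y, 0 ≤ w x y) (hm : 1 < m) (hoz : o ≠ z)
    (hho : 0 < h o) (hWo : 0 < ∑ y, w o y) (d : ι → ℝ)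
    (hd : ∀ x y, w x y ≠ 0 → |d x - d y| ≤ 1) (hdo : ∀ y, w o y ≠ 0 → d y = d o)
    (hdz : ∀ y, w z y ≠ 0 → d y = d z) (hoz' : d o ≤ d z) :
    2 * Real.log m * (d z - d o) ^ 2 ≤ (-Real.log (h o) + 1) * (-Real.log (k z) + 1) := by
  set J := ∑ y, discountedFlow w h k o y with hJ
  have hJpos : 0 < J := by
    rw [hJ, hh.flow_at_source hk hoz]
    have := hk.sum_mul_le hw o
    refine mul_pos hho ?_
    nlinarith
  have hl := Real.log_pos hm
  have hA := hh.sum_erase_entropyAt_le hk hsymm hw hm hoz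
  have hB := hk.sum_erase_entropyAt_le hh hsymm hw hm hoz.symm
  rw [hh.sum_flow_swap hk hsymm hoz] at hB
  have hset : (Finset.univ.filter fun x => x ≠ z ∧ x ≠ o) =
      Finset.univ.filter fun x => x ≠ o ∧ x ≠ z := by
    ext x; simp [and_comm]
  rw [hset] at hB
  set s := Finset.univ.filter fun x => x ≠ o ∧ x ≠ z with hs
  -- The factor 2 counts each edge in both directions. As `d` is constant along edges at `o` and
  -- `z`, these two rows drop out; `flow_le_entropy` is not available there.
  have hD : 2 * (J * (d z - d o)) ≤ ∑ x ∈ s, ∑ y, |discountedFlow w h k x y| := by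
    have h0 := flow_sum_by_parts (discountedFlow_antisymm (h := h) (k := k) hsymm) hoz
      (hh.sum_flow_eq_zero hk) (fun x => -d x)
    have h1 : ∑ x, ∑ y, discountedFlow w h k x y * (-d x - -d y) =
        ∑ x ∈ s, ∑ y, discountedFlow w h k x y * (-d x - -d y) := by
      symm
      apply Finset.sum_subset (Finset.subset_univ _)
      intro x _ hx
      refine Finset.sum_eq_zero fun y _ => ?_
      by_cases hxy : w x y = 0
      · simp [discountedFlow, hxy]
      · have : x = o ∨ x = z := by
          simp only [hs, Finset.mem_filter, Finset.mem_univ, true_and] at hx; tauto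
        rcases this with rfl | rfl
        · rw [hdo y hxy]; ring
        · rw [hdz y hxy]; ring
    rw [h1] at h0
    calc 2 * (J * (d z - d o)) = ∑ x ∈ s, ∑ y, discountedFlow w h k x y * (-d x - -d y) := by
          rw [h0]; ring
      _ ≤ _ := by
        refine Finset.sum_le_sum fun x _ => Finset.sum_le_sum fun y _ => ?_
        by_cases hxy : w x y = 0
        · simp [discountedFlow, hxy]
        · refine (le_abs_self _).trans ?_
          rw [abs_mul]
          refine mul_le_of_le_one_right (abs_nonneg _) ?_
          rw [show -d x - -d y = -(d x - d y) by ring, abs_neg]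
          exact hd x y hxy
  have hmain : Real.sqrt (Real.log m / 2) * (2 * (J * (d z - d o))) ≤
      Real.sqrt (J * (-Real.log (h o) + 1)) * Real.sqrt (J * (-Real.log (k z) + 1)) := by
    calc _ ≤ Real.sqrt (Real.log m / 2) * ∑ x ∈ s, ∑ y, |discountedFlow w h k x y| :=
          mul_le_mul_of_nonneg_left hD (Real.sqrt_nonneg _)
      _ ≤ ∑ x ∈ s, Real.sqrt (k x * entropyAt w h x) * Real.sqrt (h x * entropyAt w k x) := by
          rw [Finset.mul_sum]
          refine Finset.sum_le_sum fun x hx => ?_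
          simp only [hs, Finset.mem_filter, Finset.mem_univ, true_and] at hx
          exact hh.flow_le_entropy hk hw hm hx.1 hx.2
      _ ≤ Real.sqrt (∑ x ∈ s, k x * entropyAt w h x) *
            Real.sqrt (∑ x ∈ s, h x * entropyAt w k x) := by
          refine (Real.sum_mul_le_sqrt_mul_sqrt s _ _).trans (le_of_eq ?_)
          congr 2 <;> refine Finset.sum_congr rfl fun x hx => Real.sq_sqrt ?_
          all_goals simp only [hs, Finset.mem_filter, Finset.mem_univ, true_and] at hx
          · exact mul_nonneg (hk.nonneg x) (hh.entropyAt_nonneg hw hm hx.2)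
          · exact mul_nonneg (hh.nonneg x) (hk.entropyAt_nonneg hw hm hx.1)
      _ ≤ _ := mul_le_mul (Real.sqrt_le_sqrt hA) (Real.sqrt_le_sqrt hB) (Real.sqrt_nonneg _)
          (Real.sqrt_nonneg _)
  have ha : 0 ≤ -Real.log (h o) := neg_nonneg.2 (Real.log_nonpos hho.le (hh.le_one o))
  have hb : 0 ≤ -Real.log (k z) :=
    neg_nonneg.2 (Real.log_nonpos (hk.nonneg z) (hk.le_one z))
  have hsq := mul_self_le_mul_self (by have := sub_nonneg.2 hoz'; positivity) hmain
  have e1 : Real.sqrt (Real.log m / 2) * (2 * (J * (d z - d o))) *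
      (Real.sqrt (Real.log m / 2) * (2 * (J * (d z - d o)))) =
      J ^ 2 * (2 * Real.log m * (d z - d o) ^ 2) := by
    have := Real.mul_self_sqrt (show 0 ≤ Real.log m / 2 by positivity)
    linear_combination (2 * (J * (d z - d o))) ^ 2 * this
  have e2 : Real.sqrt (J * (-Real.log (h o) + 1)) * Real.sqrt (J * (-Real.log (k z) + 1)) *
      (Real.sqrt (J * (-Real.log (h o) + 1)) * Real.sqrt (J * (-Real.log (k z) + 1))) =
      J ^ 2 * ((-Real.log (h o) + 1) * (-Real.log (k z) + 1)) := by
    rw [← Real.sqrt_mul (by positivity), Real.mul_self_sqrt (by positivity)]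
    ring
  rw [e1, e2] at hsq
  exact le_of_mul_le_mul_left hsq (by positivity)

end Network

/-! ### Hitting times expressed by the killed transition operator. -/

namespace WeightedGraph

variable {V : Type u} (G : WeightedGraph V)

/-- The mean of a function after one step of the walk from `x`. -/
noncomputable def stepMean (f : V → ℝ≥0∞) (x : V) : ℝ≥0∞ := ∑' y, G.step x y * f y

/-- The transition operator of the walk killed on arrival in `z`. -/
noncomputable def killed (z : Set V) (f : V → ℝ≥0∞) : V → ℝ≥0∞ := G.stepMean (zᶜ.indicator f)

/-- The probability that the walk from `x ∉ z` first visits `z` at time `k + 1`. -/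
noncomputable def hitAt (z : Set V) (k : ℕ) : V → ℝ≥0∞ :=
  (G.killed z)^[k] (G.stepMean (z.indicator 1))

variable [MeasurableSpace V] [DiscreteMeasurableSpace V]

/-- The vertex set may be uncountable, but the support of a `PMF` is countable. -/
theorem lintegral_toMeasure (p : PMF V) (f : V → ℝ≥0∞) :
    ∫⁻ y, f y ∂p.toMeasure = ∑' y, p y * f y := by
  rw [← PMF.restrict_toMeasure_support, lintegral_countable _ p.support_countable]
  simp_rw [PMF.toMeasure_apply_singleton _ _ (MeasurableSet.of_discrete)]
  rw [tsum_subtype p.support (fun y => f y * p y)]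
  refine tsum_congr fun y => ?_
  by_cases hy : y ∈ p.support
  · rw [Set.indicator_of_mem hy, mul_comm]
  · rw [Set.indicator_of_notMem hy, (p.apply_eq_zero_iff y).2 hy, zero_mul]

theorem lintegral_stepKernel (f : V → ℝ≥0∞) (x : V) :
    ∫⁻ y, f y ∂(G.stepKernel x) = G.stepMean f x := lintegral_toMeasure _ f

instance (o : V) : IsProbabilityMeasure (G.walkLaw o) := by
  unfold walkLaw; infer_instance

/-- The Markov property: the joint law of the past and the next position is the composition product
of the law of the past with `pastKernel`. -/
theorem lintegral_walkLaw_succ (o : V) (n : ℕ) {g : (Finset.Iic n → V) → ℝ≥0∞}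
    (hg : Measurable g) (F : V → ℝ≥0∞) :
    ∫⁻ ω, g (Preorder.frestrictLe (π := fun _ => V) n ω) * F (ω (n + 1)) ∂(G.walkLaw o) =
      ∫⁻ ω, g (Preorder.frestrictLe (π := fun _ => V) n ω) * G.stepMean F (ω n)
        ∂(G.walkLaw o) := by
  have hF : Measurable F := Measurable.of_discrete
  have hmeas : Measurable fun q : (Finset.Iic n → V) × V => g q.1 * F q.2 :=
    (hg.comp measurable_fst).mul (hF.comp measurable_snd)
  have h1 := Kernel.partialTraj_compProd_eq_map_traj (X := fun _ => V) (κ := G.pastKernel)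
    (Nat.zero_le n) (x₀ := fun _ => o)
  have h2 := Kernel.traj_map_frestrictLe_apply (X := fun _ => V) (κ := G.pastKernel) 0 n
    (fun _ => o)
  calc _ = ∫⁻ q, g q.1 * F q.2 ∂((G.walkLaw o).map
        fun x => (Preorder.frestrictLe (π := fun _ => V) n x, x (n + 1))) := by
        rw [lintegral_map hmeas (by fun_prop)]
    _ = ∫⁻ x, ∫⁻ y, g x * F y ∂(G.pastKernel n x) ∂(Kernel.partialTraj (X := fun _ => V) G.pastKernel 0 n
          (fun _ => o)) := by
        rw [walkLaw, ← h1, Measure.lintegral_compProd hmeas]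
    _ = ∫⁻ x, g x * G.stepMean F (x ⟨n, Finset.mem_Iic.2 le_rfl⟩)
          ∂(Kernel.partialTraj (X := fun _ => V) G.pastKernel 0 n (fun _ => o)) := by
        refine lintegral_congr fun x => ?_
        rw [lintegral_const_mul _ hF]
        congr 1
        exact G.lintegral_stepKernel F _
    _ = _ := by
        rw [← h2, lintegral_map _ (by fun_prop)]
        · rfl
        · exact hg.mul ((Measurable.of_discrete (f := G.stepMean F)).comp (measurable_pi_apply _))

theorem walkLaw_zero (o : V) : ∀ᵐ ω ∂(G.walkLaw o), ω 0 = o := by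
  have h2 := Kernel.traj_map_frestrictLe_apply (X := fun _ => V) (κ := G.pastKernel) 0 0
    (fun _ => o)
  rw [Kernel.partialTraj_self, Kernel.id_apply] at h2
  have h3 : ∀ᵐ x ∂(Measure.dirac (fun _ : Finset.Iic 0 => o)),
      x ⟨0, Finset.mem_Iic.2 le_rfl⟩ = o := by
    rw [ae_dirac_iff]
    exact measurable_pi_apply (X := fun _ => V) _ (MeasurableSet.of_discrete (s := {o}))
  rw [← h2] at h3
  exact ae_of_ae_map (by fun_prop) h3

/-- The trajectories that avoid `z` up to time `k`. -/
def avoid {V : Type u} (z : Set V) (k : ℕ) : Set (ℕ → V) := {ω | ∀ i ≤ k, ω i ∉ z}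

theorem measurableSet_avoid (z : Set V) (k : ℕ) : MeasurableSet (avoid z k) := by
  have : avoid z k = ⋂ i ∈ Set.Iic k, (fun ω : ℕ → V => ω i) ⁻¹' zᶜ := by
    ext ω; simp [avoid]
  rw [this]
  exact MeasurableSet.biInter (Set.to_countable _) fun i _ =>
    measurable_pi_apply i MeasurableSet.of_discrete

theorem avoid_succ {V : Type u} (z : Set V) (k : ℕ) :
    avoid z (k + 1) = avoid z k ∩ {ω | ω (k + 1) ∉ z} := by
  ext ω
  simp only [avoid, Set.mem_ofPred_eq, Set.mem_inter_iff]
  constructor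
  · exact fun h => ⟨fun i hi => h i (by lia), h _ le_rfl⟩
  · rintro ⟨h1, h2⟩ i hi
    rcases Nat.le_or_eq_of_le_succ hi with h | rfl
    · exact h1 i h
    · exact h2

theorem lintegral_avoid_succ (o : V) (z : Set V) (k : ℕ) (F : V → ℝ≥0∞) :
    ∫⁻ ω, (avoid z k).indicator 1 ω * F (ω (k + 1)) ∂(G.walkLaw o) =
      ∫⁻ ω, (avoid z k).indicator 1 ω * G.stepMean F (ω k) ∂(G.walkLaw o) := by
  let S : Set (Finset.Iic k → V) := {x | ∀ i, x i ∉ z}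
  have hS : MeasurableSet S := by
    have : S = ⋂ i, (fun x : Finset.Iic k → V => x i) ⁻¹' zᶜ := by ext; simp [S]
    rw [this]
    exact MeasurableSet.iInter fun i => measurable_pi_apply i MeasurableSet.of_discrete
  have h := G.lintegral_walkLaw_succ o k (g := S.indicator 1)
    (measurable_one.indicator hS) F
  have e : ∀ ω : ℕ → V, S.indicator 1 (Preorder.frestrictLe (π := fun _ => V) k ω) =
      (avoid z k).indicator (1 : (ℕ → V) → ℝ≥0∞) ω := by
    intro ω
    have : Preorder.frestrictLe (π := fun _ => V) k ω ∈ S ↔ ω ∈ avoid z k := by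
      simp [S, avoid]
    by_cases hω : ω ∈ avoid z k
    · rw [Set.indicator_of_mem hω, Set.indicator_of_mem (this.2 hω)]; rfl
    · rw [Set.indicator_of_notMem hω, Set.indicator_of_notMem (mt this.1 hω)]
  simpa only [e] using h

theorem lintegral_avoid (o : V) (z : Set V) (ho : o ∉ z) (k : ℕ) (F : V → ℝ≥0∞) :
    ∫⁻ ω, (avoid z k).indicator 1 ω * F (ω k) ∂(G.walkLaw o) = (G.killed z)^[k] F o := by
  induction k generalizing F with
  | zero =>
    have : ∫⁻ ω, (avoid z 0).indicator 1 ω * F (ω 0) ∂(G.walkLaw o) =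
        ∫⁻ _, F o ∂(G.walkLaw o) := by
      refine lintegral_congr_ae ?_
      filter_upwards [G.walkLaw_zero o] with ω hω
      rw [Set.indicator_of_mem]
      · simp [hω]
      · intro i hi
        rw [Nat.le_zero.1 hi, hω]
        exact ho
    rw [this]
    simp
  | succ k ih =>
    rw [Function.iterate_succ_apply, ← ih, killed, ← G.lintegral_avoid_succ]
    refine lintegral_congr fun ω => ?_
    rw [avoid_succ]
    by_cases h1 : ω ∈ avoid z k <;> by_cases h2 : ω (k + 1) ∈ z <;>
      simp [Set.indicator, h1, h2]

theorem walkLaw_avoid (o : V) (z : Set V) (ho : o ∉ z) (k : ℕ) :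
    G.walkLaw o (avoid z k) = (G.killed z)^[k] 1 o := by
  rw [← G.lintegral_avoid o z ho, ← lintegral_indicator_one (measurableSet_avoid z k)]
  simp

theorem walkLaw_compl_avoid (o : V) (z : Set V) (ho : o ∉ z) (N : ℕ) :
    G.walkLaw o (avoid z N)ᶜ = ∑ k ∈ Finset.range N, G.hitAt z k o := by
  induction N with
  | zero =>
    have : G.walkLaw o (avoid z 0) = 1 := by rw [G.walkLaw_avoid o z ho]; rfl
    rw [prob_compl_eq_one_sub (measurableSet_avoid z 0), this]
    simp
  | succ N ih =>
    have e : (avoid z (N + 1))ᶜ = (avoid z N)ᶜ ∪ (avoid z N ∩ {ω | ω (N + 1) ∈ z}) := by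
      rw [avoid_succ]
      ext ω
      simp only [Set.mem_compl_iff, Set.mem_inter_iff, Set.mem_ofPred_eq, Set.mem_union]
      tauto
    have hm : MeasurableSet (avoid z N ∩ {ω | ω (N + 1) ∈ z}) :=
      (measurableSet_avoid z N).inter (measurable_pi_apply (N + 1) MeasurableSet.of_discrete)
    rw [e, measure_union _ hm, ih, Finset.sum_range_succ]
    · congr 1
      rw [hitAt, ← G.lintegral_avoid o z ho, ← G.lintegral_avoid_succ,
        ← lintegral_indicator_one hm]
      refine lintegral_congr fun ω => ?_
      by_cases h1 : ω ∈ avoid z N <;> by_cases h2 : ω (N + 1) ∈ z <;>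
        simp [Set.indicator, h1, h2]
    · exact Set.disjoint_left.2 fun ω h1 h2 => h1 h2.1

theorem hitTime_lt_iff {V : Type u} (z : Set V) (ω : ℕ → V) (t : ℝ≥0∞) :
    hitTime z ω < t ↔ ∃ k : ℕ, ω k ∈ z ∧ (k : ℝ≥0∞) < t := by
  simp [hitTime, iInf_lt_iff]

/-- The index `k` of `hitAt` stands for the time `k + 1`, and integer times below `t` are those at
most `⌈t⌉₊ - 1`. -/
theorem probHitBefore_eq (o : V) (z : Set V) (ho : o ∉ z) (t : ℝ) :
    G.probHitBefore o z t = ∑ k ∈ Finset.range (⌈t⌉₊ - 1), G.hitAt z k o := by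
  rw [probHitBefore]
  have hlt : ∀ k : ℕ, (k : ℝ≥0∞) < ENNReal.ofReal t ↔ k < ⌈t⌉₊ := by
    intro k
    rw [Nat.lt_ceil, ← ENNReal.ofReal_natCast, ENNReal.ofReal_lt_ofReal_iff_of_nonneg
      (Nat.cast_nonneg k)]
  rcases Nat.eq_zero_or_pos ⌈t⌉₊ with h0 | h0
  · rw [h0]
    have : {ω : ℕ → V | hitTime z ω < ENNReal.ofReal t} = ∅ := by
      ext ω
      simp [hitTime_lt_iff, hlt, h0]
    rw [this]
    simp
  · rw [← G.walkLaw_compl_avoid o z ho]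
    congr 1
    ext ω
    simp only [Set.mem_ofPred_eq, hitTime_lt_iff, hlt, avoid, Set.mem_compl_iff, not_forall,
      not_not]
    constructor
    · rintro ⟨k, h1, h2⟩
      exact ⟨k, by lia, h1⟩
    · rintro ⟨k, h1, h2⟩
      exact ⟨k, h2, by lia⟩

theorem measurable_hitTime (z : Set V) : Measurable (hitTime z) := by
  unfold hitTime
  refine Measurable.iInf fun k => ?_
  have : (fun ω : ℕ → V => ⨅ _ : ω k ∈ z, (k : ℝ≥0∞)) =
      (fun x : V => ⨅ _ : x ∈ z, (k : ℝ≥0∞)) ∘ fun ω => ω k := rfl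
  rw [this]
  exact Measurable.of_discrete.comp (measurable_pi_apply k)

theorem hitTime_le_tsum {V : Type u} (z : Set V) (ω : ℕ → V) :
    hitTime z ω ≤ ∑' k, (avoid z k).indicator 1 ω := by
  classical
  by_cases h : ∃ k, ω k ∈ z
  · have hN := Nat.find_spec h
    set N := Nat.find h with hNdef
    calc hitTime z ω ≤ N := iInf₂_le N hN
      _ = ∑ k ∈ Finset.range N, (avoid z k).indicator (1 : (ℕ → V) → ℝ≥0∞) ω := by
          rw [Finset.sum_congr rfl (g := fun _ => (1 : ℝ≥0∞))]
          · simp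
          · intro k hk
            rw [Set.indicator_of_mem]
            · rfl
            · intro i hi
              exact Nat.find_min h (by rw [Finset.mem_range] at hk; lia)
      _ ≤ _ := ENNReal.sum_le_tsum _
  · push Not at h
    have : ∀ k, (avoid z k).indicator (1 : (ℕ → V) → ℝ≥0∞) ω = 1 := fun k => by
      rw [Set.indicator_of_mem]
      · rfl
      · exact fun i _ => h i
    simp [this]

/-- The tail-sum formula for the expectation; only this inequality is needed. -/
theorem expectedHit_le_tsum (o : V) (z : Set V) (ho : o ∉ z) :
    G.expectedHit o z ≤ ∑' k, (G.killed z)^[k] 1 o := by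
  calc G.expectedHit o z ≤ ∫⁻ ω, ∑' k, (avoid z k).indicator 1 ω ∂(G.walkLaw o) :=
        lintegral_mono (hitTime_le_tsum z)
    _ = ∑' k, ∫⁻ ω, (avoid z k).indicator 1 ω ∂(G.walkLaw o) :=
        lintegral_tsum fun k => (measurable_one.indicator (measurableSet_avoid z k)).aemeasurable
    _ = _ := tsum_congr fun k => by
        rw [lintegral_indicator_one (measurableSet_avoid z k), G.walkLaw_avoid o z ho]

/-- Markov's inequality. -/
theorem ofReal_mul_le_expectedHit (o : V) (z : Set V) (t : ℝ) :
    ENNReal.ofReal t * (1 - G.probHitBefore o z t) ≤ G.expectedHit o z := by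
  refine le_trans ?_ (mul_meas_ge_le_lintegral₀ (measurable_hitTime z).aemeasurable
    (ENNReal.ofReal t))
  gcongr
  rw [probHitBefore, ← prob_compl_eq_one_sub (measurableSet_lt (measurable_hitTime z)
    measurable_const)]
  refine measure_mono fun ω hω => ?_
  simpa using hω

end WeightedGraph

/-! ### The Laplace transform: reduction to finite networks and the universal bound. -/

namespace WeightedGraph

variable {V : Type u} (G : WeightedGraph V)

theorem stepMean_mono {f g : V → ℝ≥0∞} (h : f ≤ g) : G.stepMean f ≤ G.stepMean g :=
  fun _ => ENNReal.tsum_le_tsum fun y => mul_le_mul_right (h y) _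

theorem killed_sum (z : Set V) {ι : Type*} (s : Finset ι) (c : ι → ℝ≥0∞) (f : ι → V → ℝ≥0∞)
    (x : V) : G.killed z (fun y => ∑ i ∈ s, c i * f i y) x = ∑ i ∈ s, c i * G.killed z (f i) x := by
  simp only [killed, stepMean, ← ENNReal.tsum_mul_left]
  rw [← Summable.tsum_finsetSum fun _ _ => ENNReal.summable]
  refine tsum_congr fun y => ?_
  by_cases hy : y ∈ z
  · simp [hy]
  · simp only [Set.indicator_of_mem (Set.mem_compl hy), Finset.mul_sum]
    exact Finset.sum_congr rfl fun i _ => by ring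

theorem hitAt_succ (z : Set V) (k : ℕ) : G.hitAt z (k + 1) = G.killed z (G.hitAt z k) :=
  Function.iterate_succ_apply' _ _ _

/-- The discounted probability `∑ γ ^ T` of a visit to `z` up to time `N`. -/
noncomputable def laplace (z : Set V) (γ : ℝ≥0∞) (N : ℕ) (x : V) : ℝ≥0∞ :=
  ∑ k ∈ Finset.range N, γ ^ (k + 1) * G.hitAt z k x

theorem laplace_succ (z : Set V) (γ : ℝ≥0∞) (N : ℕ) (x : V) :
    G.laplace z γ (N + 1) x =
      γ * (G.stepMean (z.indicator 1) x + G.killed z (G.laplace z γ N) x) := by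
  have h : G.killed z (G.laplace z γ N) x =
      ∑ k ∈ Finset.range N, γ ^ (k + 1) * G.hitAt z (k + 1) x := by
    simp only [hitAt_succ]
    exact G.killed_sum z _ (fun k => γ ^ (k + 1)) (G.hitAt z) x
  rw [h, laplace, Finset.sum_range_succ', add_comm, mul_add, Finset.mul_sum]
  congr 1
  · simp [hitAt]
  · exact Finset.sum_congr rfl fun k _ => by ring

/-- The variant of `laplace` in which the walk is killed outside of a finite set `F`. -/
noncomputable def truncLaplace (z : Set V) (γ : ℝ≥0∞) (F : Finset V) : ℕ → V → ℝ≥0∞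
  | 0 => 0
  | N + 1 => fun x => γ * (G.stepMean (z.indicator 1) x +
      ∑ y ∈ F, G.step x y * zᶜ.indicator (truncLaplace z γ F N) y)

theorem truncLaplace_mono (z : Set V) (γ : ℝ≥0∞) (N : ℕ) (x : V) :
    Monotone fun F => G.truncLaplace z γ F N x := by
  induction N generalizing x with
  | zero => exact fun _ _ _ => le_rfl
  | succ N ih =>
    intro F F' hF
    simp only [truncLaplace]
    gcongr
    refine (Finset.sum_le_sum fun y _ => ?_).trans (Finset.sum_le_sum_of_subset hF)
    exact mul_le_mul_right (Set.indicator_le_indicator' fun _ => ih y hF) _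

/-- Monotone convergence along finite sets, one step at a time: finite sets found at different steps
are merged by a union. -/
theorem laplace_le_iSup (z : Set V) (γ : ℝ≥0∞) (N : ℕ) (x : V) :
    G.laplace z γ N x ≤ ⨆ F, G.truncLaplace z γ F N x := by
  classical
  induction N generalizing x with
  | zero => simp [laplace]
  | succ N ih =>
    have hind : ∀ y, zᶜ.indicator (G.laplace z γ N) y ≤
        ⨆ F, zᶜ.indicator (G.truncLaplace z γ F N) y := by
      intro y
      by_cases hy : y ∈ z
      · simp [hy]
      · simpa [hy] using ih y
    have hmono : ∀ y, Monotone fun F => G.step x y * zᶜ.indicator (G.truncLaplace z γ F N) y :=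
      fun y F F' hF =>
        mul_le_mul_right (Set.indicator_le_indicator' fun _ => G.truncLaplace_mono z γ N y hF) _
    rw [laplace_succ, killed, stepMean, stepMean, ENNReal.tsum_eq_iSup_sum
      (f := fun y => G.step x y * zᶜ.indicator (G.laplace z γ N) y), ENNReal.add_iSup,
      ENNReal.mul_iSup]
    refine iSup_le fun F₀ => ?_
    calc _ ≤ γ * (∑' y, G.step x y * z.indicator 1 y +
          ∑ y ∈ F₀, ⨆ F, G.step x y * zᶜ.indicator (G.truncLaplace z γ F N) y) := by
          gcongr with y hy
          rw [← ENNReal.mul_iSup]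
          exact mul_le_mul_right (hind y) _
      _ ≤ _ := by
          rw [ENNReal.finsetSum_iSup_of_monotone hmono, ENNReal.add_iSup, ENNReal.mul_iSup]
          refine iSup_le fun F => le_iSup_of_le (F₀ ∪ F) ?_
          simp only [truncLaplace]
          gcongr
          · exact le_rfl
          · refine (Finset.sum_le_sum fun y _ => hmono y Finset.subset_union_right).trans
              (Finset.sum_le_sum_of_subset Finset.subset_union_left)

theorem step_apply {x : V} (hx : G.vertexWeight x ≠ 0) (y : V) :
    G.step x y = G.w x y * (G.vertexWeight x)⁻¹ := by
  rw [vertexWeight] at hx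
  rw [step, dif_neg hx, PMF.normalize_apply, vertexWeight]

theorem w_le_vertexWeight (x y : V) : (G.w x y : ℝ≥0∞) ≤ G.vertexWeight x :=
  ENNReal.le_tsum (f := fun y => (G.w x y : ℝ≥0∞)) y

/-- The total weight of the edges from `x` to `z`. -/
noncomputable def weightTo (z : Set V) (x : V) : ℝ≥0∞ :=
  ∑' y, z.indicator (fun y => (G.w x y : ℝ≥0∞)) y

theorem stepMean_indicator_one {x : V} (hx : G.vertexWeight x ≠ 0) (z : Set V) :
    G.stepMean (z.indicator 1) x = G.weightTo z x * (G.vertexWeight x)⁻¹ := by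
  rw [stepMean, weightTo, ← ENNReal.tsum_mul_right]
  refine tsum_congr fun y => ?_
  rw [G.step_apply hx]
  by_cases hy : y ∈ z <;> simp [hy]

theorem weightTo_add_sum_le (z : Set V) (S : Finset V) (hS : ∀ x ∈ S, x ∉ z) (x : V) :
    G.weightTo z x + ∑ u ∈ S, (G.w x u : ℝ≥0∞) ≤ G.vertexWeight x := by
  rw [← Finset.tsum_subtype' S (fun u => (G.w x u : ℝ≥0∞)),
    tsum_subtype (S : Set V) (fun u => (G.w x u : ℝ≥0∞)), weightTo, ← ENNReal.tsum_add]
  refine ENNReal.tsum_le_tsum fun y => ?_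
  by_cases hy : y ∈ S
  · simp [hy, hS y hy]
  · simp only [Set.indicator_of_notMem (show y ∉ (S : Set V) from hy), add_zero]
    exact Set.indicator_le_self _ _ _

theorem sum_weightTo_le (z : Set V) (S : Finset V) :
    ∑ x ∈ S, G.weightTo z x ≤ G.setWeight z := by
  refine (ENNReal.sum_le_tsum S).trans (le_of_eq ?_)
  simp only [weightTo]
  rw [ENNReal.tsum_comm, setWeight, tsum_subtype z G.vertexWeight]
  refine tsum_congr fun y => ?_
  by_cases hy : y ∈ z
  · simp only [hy, Set.indicator_of_mem, vertexWeight]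
    exact tsum_congr fun x => by rw [G.symm]
  · simp [hy]

theorem weightTo_ne_top (z : Set V) (x : V) : G.weightTo z x ≠ ⊤ :=
  ne_top_of_le_ne_top (G.tsum_ne_top x)
    (le_self_add.trans (G.weightTo_add_sum_le z ∅ (by simp) x))

open scoped Classical in
/-- The finite network obtained from `G` by collapsing `z` to one vertex `none`, and turning the
edges that leave `S ∪ z` into loops. -/
noncomputable def collapse (z : Set V) (S : Finset V) : Option S → Option S → ℝ
  | none, none => 0
  | some x, none => (G.weightTo z x).toReal
  | none, some x => (G.weightTo z x).toReal
  | some x, some y =>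
    if x = y then (G.vertexWeight x).toReal - (G.weightTo z x).toReal -
      ∑ u ∈ S.erase x, (G.w x u : ℝ) else G.w x y

theorem collapse_symm (z : Set V) (S : Finset V) (x y : Option S) :
    G.collapse z S x y = G.collapse z S y x := by
  rcases x with _ | x <;> rcases y with _ | y <;> simp only [collapse]
  by_cases h : x = y
  · subst h; rfl
  · rw [if_neg h, if_neg (Ne.symm h), G.symm]

theorem weightTo_add_sum_le_toReal (z : Set V) (S : Finset V) (hS : ∀ x ∈ S, x ∉ z) (x : V) :
    (G.weightTo z x).toReal + ∑ u ∈ S, (G.w x u : ℝ) ≤ (G.vertexWeight x).toReal := by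
  have h := ENNReal.toReal_mono (G.tsum_ne_top x) (G.weightTo_add_sum_le z S hS x)
  rw [ENNReal.toReal_add (G.weightTo_ne_top z x) (by simp), ENNReal.toReal_sum (by simp)] at h
  simpa [vertexWeight] using h

theorem w_le_collapse (z : Set V) (S : Finset V) (hS : ∀ x ∈ S, x ∉ z) (x y : S) :
    (G.w x y : ℝ) ≤ G.collapse z S (some x) (some y) := by
  classical
  simp only [collapse]
  split_ifs with h
  · subst h
    have h1 := G.weightTo_add_sum_le_toReal z S hS x
    rw [← Finset.add_sum_erase S _ x.2] at h1
    linarith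
  · exact le_rfl

theorem collapse_nonneg (z : Set V) (S : Finset V) (hS : ∀ x ∈ S, x ∉ z) (x y : Option S) :
    0 ≤ G.collapse z S x y := by
  rcases x with _ | x <;> rcases y with _ | y
  · exact le_rfl
  · exact ENNReal.toReal_nonneg
  · exact ENNReal.toReal_nonneg
  · exact (NNReal.coe_nonneg _).trans (G.w_le_collapse z S hS x y)

/-- The loops are chosen to leave the vertex weights unchanged. -/
theorem sum_collapse_some (z : Set V) (S : Finset V) (x : S) :
    ∑ y, G.collapse z S (some x) y = (G.vertexWeight x).toReal := by
  classical
  rw [Fintype.sum_option, ← Finset.add_sum_erase Finset.univ _ (Finset.mem_univ x)]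
  have h1 : ∑ y ∈ Finset.univ.erase x, G.collapse z S (some x) (some y) =
      ∑ u ∈ S.erase x, (G.w x u : ℝ) := by
    have e : ∑ y ∈ Finset.univ.erase x, G.collapse z S (some x) (some y) =
        ∑ y ∈ Finset.univ.erase x, (G.w x y : ℝ) := by
      refine Finset.sum_congr rfl fun y hy => ?_
      simp only [collapse]
      rw [if_neg (Finset.ne_of_mem_erase hy).symm]
    have e1 := Finset.add_sum_erase (Finset.univ : Finset S) (fun y => (G.w x y : ℝ))
      (Finset.mem_univ x)
    have e2 := Finset.add_sum_erase S (fun y => (G.w x y : ℝ)) x.2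
    have e3 := Finset.sum_coe_sort S (fun y => (G.w x y : ℝ))
    linarith
  rw [h1]
  simp only [collapse, if_true]
  ring

theorem sum_collapse_none_le (z : Set V) (S : Finset V) (hz : G.setWeight z ≠ ⊤) :
    ∑ y, G.collapse z S none y ≤ (G.setWeight z).toReal := by
  rw [Fintype.sum_option]
  simp only [collapse, zero_add]
  rw [Finset.sum_coe_sort S (fun y => (G.weightTo z y).toReal),
    ← ENNReal.toReal_sum fun x _ => G.weightTo_ne_top z x]
  exact ENNReal.toReal_mono hz (G.sum_weightTo_le z S)

/-- Walks that leave `S ∪ z` are killed on the left and merely held back by loops on the right, so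
`h` satisfies the recursion of `truncLaplace` with `≥`. Neighbours reached with positive weight have
positive weight, which keeps the induction away from isolated vertices. -/
theorem truncLaplace_le (z : Set V) (F S : Finset V) (hS : ∀ x ∈ S, x ∉ z)
    (hFS : ∀ x ∈ F, x ∉ z → x ∈ S) {l : ℝ} {h : Option S → ℝ}
    (hh : IsDiscounted (G.collapse z S) (Real.exp l) none h) (N : ℕ) (x : S)
    (hx : G.vertexWeight x ≠ 0) :
    G.truncLaplace z (ENNReal.ofReal (Real.exp (-l))) F N x ≤ ENNReal.ofReal (h (some x)) := by
  classical
  induction N generalizing x with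
  | zero => simp [truncLaplace]
  | succ N ih =>
    have hxtop : G.vertexWeight x ≠ ⊤ := G.tsum_ne_top x
    have hWpos : 0 < (G.vertexWeight x).toReal := ENNReal.toReal_pos hx hxtop
    have hsum : ∑ y ∈ F, G.step x y * zᶜ.indicator
          (G.truncLaplace z (ENNReal.ofReal (Real.exp (-l))) F N) y ≤
        ∑ y : S, G.w x y * (G.vertexWeight x)⁻¹ * ENNReal.ofReal (h (some y)) := by
      let g : V → ℝ≥0∞ := fun y => G.w x y * (G.vertexWeight x)⁻¹ *
        (if hy : y ∈ S then ENNReal.ofReal (h (some ⟨y, hy⟩)) else 0)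
      have e : ∑ y : S, G.w x y * (G.vertexWeight x)⁻¹ * ENNReal.ofReal (h (some y)) =
          ∑ y ∈ S, g y := by
        rw [← Finset.sum_coe_sort S g]
        refine Finset.sum_congr rfl fun y _ => ?_
        simp [g]
      rw [e]
      have e2 : ∑ y ∈ F, G.step x y * zᶜ.indicator
          (G.truncLaplace z (ENNReal.ofReal (Real.exp (-l))) F N) y ≤ ∑ y ∈ F ∩ S, g y := by
        rw [← Finset.sum_subset (Finset.inter_subset_left : F ∩ S ⊆ F)]
        · refine Finset.sum_le_sum fun y hy => ?_
          rw [Finset.mem_inter] at hy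
          rw [G.step_apply hx, Set.indicator_of_mem (hS y hy.2)]
          by_cases hw : G.w x y = 0
          · simp [hw]
          · have hy0 : G.vertexWeight y ≠ 0 := by
              have := G.w_le_vertexWeight y x
              rw [G.symm] at this
              intro h0
              rw [h0] at this
              simp at this
              exact hw this
            simp only [g, dif_pos hy.2]
            exact mul_le_mul_right (ih ⟨y, hy.2⟩ hy0) _
        · intro y hyF hy
          have : y ∈ z := by
            by_contra hyz
            exact hy (Finset.mem_inter.2 ⟨hyF, hFS y hyF hyz⟩)
          simp [this]
      exact e2.trans (Finset.sum_le_sum_of_subset Finset.inter_subset_right)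
    have hmean := hh.mean (some x) (by simp)
    rw [sum_collapse_some, Fintype.sum_option, hh.target, mul_one] at hmean
    have hle : (G.weightTo z x).toReal + ∑ y : S, (G.w x y : ℝ) * h (some y) ≤
        Real.exp l * (G.vertexWeight x).toReal * h (some x) := by
      rw [← hmean]
      simp only [collapse.eq_2]
      gcongr with y hy
      · exact hh.nonneg _
      · exact G.w_le_collapse z S hS x y
    have hcast : G.weightTo z x * (G.vertexWeight x)⁻¹ +
        ∑ y : S, G.w x y * (G.vertexWeight x)⁻¹ * ENNReal.ofReal (h (some y)) =
        ENNReal.ofReal (((G.weightTo z x).toReal + ∑ y : S, (G.w x y : ℝ) * h (some y)) *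
          (G.vertexWeight x).toReal⁻¹) := by
      have hnn : ∀ y : S, 0 ≤ (G.w x y : ℝ) * h (some y) := fun y =>
        mul_nonneg (NNReal.coe_nonneg _) (hh.nonneg _)
      rw [ENNReal.ofReal_mul (add_nonneg ENNReal.toReal_nonneg (Finset.sum_nonneg fun y _ => hnn y)),
        ENNReal.ofReal_add ENNReal.toReal_nonneg (Finset.sum_nonneg fun y _ => hnn y),
        ENNReal.ofReal_toReal (G.weightTo_ne_top z x), ENNReal.ofReal_inv_of_pos hWpos,
        ENNReal.ofReal_toReal hxtop, ENNReal.ofReal_sum_of_nonneg fun y _ => hnn y, add_mul,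
        Finset.sum_mul]
      congr 1
      refine Finset.sum_congr rfl fun y _ => ?_
      rw [ENNReal.ofReal_mul (NNReal.coe_nonneg _), ENNReal.ofReal_coe_nnreal]
      ring
    simp only [truncLaplace]
    rw [G.stepMean_indicator_one hx]
    refine (mul_le_mul_right (add_le_add_right hsum _) _).trans ?_
    rw [hcast, ← ENNReal.ofReal_mul (Real.exp_pos _).le]
    apply ENNReal.ofReal_le_ofReal
    rw [← mul_assoc, ← div_eq_mul_inv, div_le_iff₀ hWpos, Real.exp_neg, inv_mul_le_iff₀
      (Real.exp_pos _)]
    linarith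

/-- The distance from `o`, cut off at `n`. -/
noncomputable def cutDist (o : V) (n : ℕ) (x : V) : ℕ := (min (G.support.edist o x) n).toNat

theorem coe_cutDist (o : V) (n : ℕ) (x : V) :
    (G.cutDist o n x : ℕ∞) = min (G.support.edist o x) n :=
  ENat.natCast_toNat (ne_of_lt ((min_le_right _ _).trans_lt (ENat.natCast_lt_top n)))

theorem cutDist_self (o : V) (n : ℕ) : G.cutDist o n o = 0 := by
  simp [cutDist]

theorem cutDist_le_succ (o : V) (n : ℕ) {x y : V} (h : G.w x y ≠ 0) :
    G.cutDist o n y ≤ G.cutDist o n x + 1 := by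
  by_cases hxy : x = y
  · subst hxy; lia
  have hadj : G.support.edist x y = 1 := SimpleGraph.edist_eq_one_iff_adj.2 ⟨hxy, h⟩
  have h1 : G.support.edist o y ≤ G.support.edist o x + 1 := by
    rw [← hadj]; exact SimpleGraph.edist_triangle
  have h2 : (G.cutDist o n y : ℕ∞) ≤ (G.cutDist o n x : ℕ∞) + 1 := by
    rw [coe_cutDist, coe_cutDist]
    rcases le_total (G.support.edist o x) n with hx | hx
    · rw [min_eq_left hx]
      exact (min_le_left _ _).trans h1
    · rw [min_eq_right hx]
      exact (min_le_right _ _).trans le_self_add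
  exact_mod_cast h2

theorem cutDist_of_mem {o : V} {n : ℕ} {z : Set V} (h : (n : ℕ∞) ≤ G.distTo o z) {x : V}
    (hx : x ∈ z) : G.cutDist o n x = n := by
  have h1 : (n : ℕ∞) ≤ G.support.edist o x := h.trans (iInf₂_le x hx)
  have h2 := G.coe_cutDist o n x
  rw [min_eq_right h1] at h2
  exact_mod_cast h2

theorem pred_le_cutDist_of_weightTo_ne_zero {o : V} {n : ℕ} {z : Set V}
    (h : (n : ℕ∞) ≤ G.distTo o z) {x : V} (hx : G.weightTo z x ≠ 0) :
    n ≤ G.cutDist o n x + 1 := by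
  have : ∃ y ∈ z, G.w x y ≠ 0 := by
    by_contra! hcon
    apply hx
    rw [weightTo, ENNReal.tsum_eq_zero]
    intro y
    by_cases hy : y ∈ z
    · simp [hy, hcon y hy]
    · simp [hy]
  obtain ⟨y, hy, hw⟩ := this
  rw [← G.cutDist_of_mem h hy]
  convert G.cutDist_le_succ o n hw using 2
  rw [G.cutDist_of_mem h hy]

/-- The exponent in the universal bound for the Laplace transform of the hitting time. -/
noncomputable def rate (R l : ℝ) (n : ℕ) : ℝ :=
  Real.sqrt ((Real.log (R * Real.exp l / (Real.exp l - 1)) / 2) ^ 2 + 2 * l * ((n : ℝ) - 2) ^ 2) -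
    Real.log (R * Real.exp l / (Real.exp l - 1)) / 2 - 1

/-- The universal bound for the Laplace transform of the hitting time. -/
theorem laplace_le (z : Set V) (o : V) (n : ℕ) (hn : 2 ≤ n) (ho : 0 < G.vertexWeight o)
    (hdist : (n : ℕ∞) ≤ G.distTo o z) {R : ℝ} (hR : 0 < R)
    (hz : G.setWeight z / G.vertexWeight o ≤ ENNReal.ofReal R) {l : ℝ} (hl : 0 < l) (N : ℕ) :
    G.laplace z (ENNReal.ofReal (Real.exp (-l))) N o ≤
      ENNReal.ofReal (Real.exp (-rate R l n)) := by
  classical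
  have hoz : o ∉ z := fun h => by
    have := G.cutDist_of_mem hdist h
    rw [cutDist_self] at this
    lia
  have hotop : G.vertexWeight o ≠ ⊤ := G.tsum_ne_top o
  have hWo : 0 < (G.vertexWeight o).toReal := ENNReal.toReal_pos ho.ne' hotop
  have hztop : G.setWeight z ≠ ⊤ := by
    intro h
    rw [h, ENNReal.top_div_of_ne_top hotop] at hz
    simp at hz
  have hzR : (G.setWeight z).toReal ≤ R * (G.vertexWeight o).toReal := by
    rw [ENNReal.div_le_iff ho.ne' hotop] at hz
    have := ENNReal.toReal_mono (ENNReal.mul_ne_top ENNReal.ofReal_ne_top hotop) hz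
    rwa [ENNReal.toReal_mul, ENNReal.toReal_ofReal hR.le] at this
  refine (G.laplace_le_iSup z _ N o).trans (iSup_le fun F => ?_)
  let S : Finset V := (insert o F).filter (· ∉ z)
  have hS : ∀ x ∈ S, x ∉ z := fun x hx => (Finset.mem_filter.1 hx).2
  have hFS : ∀ x ∈ F, x ∉ z → x ∈ S := fun x hx hxz =>
    Finset.mem_filter.2 ⟨Finset.mem_insert_of_mem hx, hxz⟩
  have hoS : o ∈ S := Finset.mem_filter.2 ⟨Finset.mem_insert_self _ _, hoz⟩
  set m := Real.exp l with hm
  have hm1 : 1 < m := Real.one_lt_exp_iff.2 hl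
  have hm0 : 0 < m := one_pos.trans hm1
  have hsymm := G.collapse_symm z S
  have hnn := G.collapse_nonneg z S hS
  obtain ⟨h, hh⟩ := exists_isDiscounted (G.collapse z S) hnn hm1 none
  obtain ⟨k, hk⟩ := exists_isDiscounted (G.collapse z S) hnn hm1 (some ⟨o, hoS⟩)
  refine (G.truncLaplace_le z F S hS hFS hh N ⟨o, hoS⟩ ho.ne').trans ?_
  apply ENNReal.ofReal_le_ofReal
  rcases (hh.nonneg (some ⟨o, hoS⟩)).eq_or_lt with hA | hA
  · rw [← hA]; exact (Real.exp_pos _).le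
  have hne : (some ⟨o, hoS⟩ : Option S) ≠ none := by simp
  have hrev := hh.reverse_bound hk hsymm hnn hne
  rw [sum_collapse_some] at hrev
  have hcn := G.sum_collapse_none_le z S hztop
  -- The distance from `o` clipped to `[1, n - 1]`: this makes it constant along the edges at `o`
  -- and at `z`, and turns the distance `n` into `n - 2`.
  let d : Option S → ℝ := fun x => match x with
    | none => ((n - 1 : ℕ) : ℝ)
    | some x => ((max 1 (min (G.cutDist o n x) (n - 1)) : ℕ) : ℝ)
  have hdno : ∀ x : S, (G.weightTo z x).toReal ≠ 0 → d (some x) = d none := by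
    intro x hx
    have h1 := G.pred_le_cutDist_of_weightTo_ne_zero hdist (x := x)
      (fun h0 => hx (by rw [h0]; rfl))
    simp only [d]
    congr 1
    lia
  have hdo : d (some ⟨o, hoS⟩) = 1 := by
    simp [d, cutDist_self]
  have hlip : ∀ x y : V, G.w x y ≠ 0 → max 1 (min (G.cutDist o n x) (n - 1)) ≤
      max 1 (min (G.cutDist o n y) (n - 1)) + 1 := fun x y hxy => by
    have := G.cutDist_le_succ o n (x := y) (y := x) (by rwa [G.symm])
    lia
  have hrate := hh.rate_mul_rate_ge hk hsymm hnn hm1 hne hA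
    (by rw [sum_collapse_some]; exact hWo) d
    (by
      rintro (_ | x) (_ | y) hxy
      · simp
      · rw [hdno y hxy]; simp
      · rw [hdno x hxy]; simp
      · by_cases hxy' : x = y
        · simp [hxy']
        · simp only [collapse, if_neg hxy'] at hxy
          have hw : G.w x y ≠ 0 := fun h0 => hxy (by rw [h0]; rfl)
          have h1 : d (some x) ≤ d (some y) + 1 := by
            simp only [d]; exact_mod_cast hlip x y hw
          have h2 : d (some y) ≤ d (some x) + 1 := by
            simp only [d]; exact_mod_cast hlip y x (by rwa [G.symm])
          rw [abs_le]
          constructor <;> linarith)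
    (by
      rintro (_ | y) hy
      · exact (hdno _ hy).symm
      · by_cases hxy' : (⟨o, hoS⟩ : S) = y
        · rw [hxy']
        · simp only [collapse, if_neg hxy'] at hy
          have hw : G.w o y ≠ 0 := fun h0 => hy (by rw [h0]; rfl)
          have := G.cutDist_le_succ o n hw
          rw [cutDist_self] at this
          rw [hdo]
          simp only [d]
          have e : max 1 (min (G.cutDist o n y) (n - 1)) = 1 := by lia
          rw [e]
          simp)
    (by
      rintro (_ | y) hy
      · rfl
      · exact hdno y hy)
    (by
      rw [hdo]
      simp only [d]
      exact_mod_cast (by lia : 1 ≤ n - 1))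
  rw [hdo, show d none - 1 = (n : ℝ) - 2 by
    simp only [d]; rw [Nat.cast_sub (by lia)]; push_cast; ring, hm, Real.log_exp] at hrate
  set A := h (some ⟨o, hoS⟩)
  set B := k none
  have hBR : A * (m - 1) ≤ B * m * R := by
    have h1 : A * (m - 1) * (G.vertexWeight o).toReal ≤ B * m * R * (G.vertexWeight o).toReal := by
      refine hrev.trans ?_
      have : 0 ≤ B * m := mul_nonneg (hk.nonneg _) hm0.le
      calc _ ≤ B * m * (R * (G.vertexWeight o).toReal) :=
            mul_le_mul_of_nonneg_left (hcn.trans hzR) this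
        _ = _ := by ring
    exact le_of_mul_le_mul_right h1 hWo
  have hB : 0 < B := by
    have : 0 < A * (m - 1) := mul_pos hA (by linarith)
    have h2 : 0 < B * m * R := this.trans_le hBR
    by_contra! hneg
    nlinarith [mul_pos hm0 hR]
  set L := Real.log (R * m / (m - 1)) with hL
  have hm1' : 0 < m - 1 := by linarith
  have hlog : Real.log A ≤ Real.log B + L := by
    rw [hL, ← Real.log_mul hB.ne' (by positivity)]
    refine Real.log_le_log hA ?_
    rw [mul_div_assoc', le_div_iff₀ hm1']
    linarith
  have ha : Real.log A ≤ 0 := Real.log_nonpos hA.le (hh.le_one _)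
  have hb : Real.log B ≤ 0 := Real.log_nonpos hB.le (hk.le_one _)
  -- With `X = 1 - log A` and `-log B ≤ -log A + L`, the bound becomes `2 l (n - 2)^2 ≤ X (X + L)`;
  -- complete the square.
  have hfin : Real.sqrt ((L / 2) ^ 2 + 2 * l * ((n : ℝ) - 2) ^ 2) ≤ -Real.log A + 1 + L / 2 := by
    refine Real.sqrt_le_iff.2 ⟨by linarith, ?_⟩
    have : (-Real.log A + 1) * (-Real.log B + 1) ≤ (-Real.log A + 1) * (-Real.log A + 1 + L) :=
      mul_le_mul_of_nonneg_left (by linarith) (by linarith)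
    nlinarith
  rw [← Real.log_le_iff_le_exp hA, rate, ← hm, ← hL]
  linarith

end WeightedGraph

/-! ### Asymptotics, and the bounds valid for all admissible graphs. -/

theorem tendsto_log_natCast_atTop : Tendsto (fun n : ℕ => Real.log n) atTop atTop :=
  Real.tendsto_log_atTop.comp tendsto_natCast_atTop_atTop

theorem tendsto_log_div_natCast : Tendsto (fun n : ℕ => Real.log n / n) atTop (𝓝 0) :=
  (Real.isLittleO_log_id_atTop.tendsto_div_nhds_zero).comp tendsto_natCast_atTop_atTop

theorem tendsto_log_log_div_log :
    Tendsto (fun n : ℕ => Real.log (Real.log n) / Real.log n) atTop (𝓝 0) :=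
  (Real.isLittleO_log_id_atTop.tendsto_div_nhds_zero).comp tendsto_log_natCast_atTop

theorem tendsto_const_div_log (a : ℝ) : Tendsto (fun n : ℕ => a / Real.log n) atTop (𝓝 0) :=
  tendsto_const_nhds.div_atTop tendsto_log_natCast_atTop

/-- The killing parameter `ℓ (log n / n) ^ 2`. -/
noncomputable def killRate (ℓ : ℝ) (n : ℕ) : ℝ := ℓ * (Real.log n / n) ^ 2

theorem tendsto_killRate (ℓ : ℝ) : Tendsto (killRate ℓ) atTop (𝓝 0) := by
  have := (tendsto_log_div_natCast.pow 2).const_mul ℓ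
  rw [zero_pow two_ne_zero, mul_zero] at this
  exact this

theorem eventually_one_lt_log : ∀ᶠ n : ℕ in atTop, 1 < Real.log n :=
  tendsto_log_natCast_atTop.eventually_gt_atTop 1

theorem tendsto_expm1_div : Tendsto (fun x : ℝ => (Real.exp x - 1) / x) (𝓝[≠] 0) (𝓝 1) := by
  have h := hasDerivAt_iff_tendsto_slope_zero.1 (Real.hasDerivAt_exp 0)
  simp only [zero_add, Real.exp_zero, smul_eq_mul] at h
  refine h.congr fun x => ?_
  rw [div_eq_inv_mul]

theorem eventually_killRate_pos {ℓ : ℝ} (hℓ : 0 < ℓ) : ∀ᶠ n : ℕ in atTop, 0 < killRate ℓ n := by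
  filter_upwards [eventually_one_lt_log, eventually_gt_atTop 0] with n hn hn0
  have : (0 : ℝ) < n := by exact_mod_cast hn0
  unfold killRate
  positivity

theorem tendsto_killRate_ne {ℓ : ℝ} (hℓ : 0 < ℓ) : Tendsto (killRate ℓ) atTop (𝓝[≠] 0) :=
  tendsto_nhdsWithin_iff.2 ⟨tendsto_killRate ℓ,
    (eventually_killRate_pos hℓ).mono fun _ h => h.ne'⟩

/-- Here `p` becomes `p + 2`: `exp l - 1` is asymptotic to `ℓ (log n / n)^2`, whose inverse
contributes `2 log n` up to `o(log n)`. -/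
theorem tendsto_log_weight_div_log {c p ℓ : ℝ} (hc : 0 < c) (hℓ : 0 < ℓ) :
    Tendsto (fun n : ℕ => Real.log (c * (n : ℝ) ^ p * Real.exp (killRate ℓ n) /
      (Real.exp (killRate ℓ n) - 1)) / Real.log n) atTop (𝓝 (p + 2)) := by
  have h1 : Tendsto (fun n : ℕ => Real.log ((Real.exp (killRate ℓ n) - 1) / killRate ℓ n))
      atTop (𝓝 (Real.log 1)) :=
    ((Real.continuousAt_log one_ne_zero).tendsto.comp tendsto_expm1_div).comp
      (tendsto_killRate_ne hℓ)
  have h2 := h1.div_atTop tendsto_log_natCast_atTop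
  have h3 := (tendsto_killRate ℓ).div_atTop tendsto_log_natCast_atTop
  have h4 := tendsto_const_div_log (Real.log c)
  have h5 := tendsto_const_div_log (Real.log ℓ)
  have h6 := tendsto_log_log_div_log.const_mul 2
  have h7 := (((((h4.add_const p).add h3).sub h2).sub h5).sub h6).add_const 2
  simp only [zero_add, mul_zero, add_zero, sub_zero] at h7
  refine h7.congr' ?_
  filter_upwards [eventually_one_lt_log, eventually_gt_atTop 0, eventually_killRate_pos hℓ]
    with n hn hn0 hk
  have hn0' : (0 : ℝ) < n := by exact_mod_cast hn0
  have hl : 0 < Real.log n := by linarith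
  have he : 0 < Real.exp (killRate ℓ n) - 1 := by
    have := Real.one_lt_exp_iff.2 hk; linarith
  rw [Real.log_div (by positivity) he.ne', Real.log_mul (by positivity) (by positivity),
    Real.log_mul hc.ne' (by positivity), Real.log_rpow hn0', Real.log_exp,
    Real.log_div he.ne' hk.ne']
  have : Real.log (killRate ℓ n) = Real.log ℓ + 2 * (Real.log (Real.log n) - Real.log n) := by
    rw [killRate, Real.log_mul hℓ.ne' (by positivity), Real.log_pow,
      Real.log_div hl.ne' hn0'.ne']
    push_cast; ring
  rw [this]
  field_simp
  ring

theorem tendsto_rate_div_log {c p ℓ : ℝ} (hc : 0 < c) (hℓ : 0 < ℓ) :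
    Tendsto (fun n : ℕ => WeightedGraph.rate (c * (n : ℝ) ^ p) (killRate ℓ n) n / Real.log n)
      atTop (𝓝 (Real.sqrt (((p + 2) / 2) ^ 2 + 2 * ℓ) - (p + 2) / 2)) := by
  have hL := (tendsto_log_weight_div_log (p := p) hc hℓ).div_const 2
  have h1 : Tendsto (fun n : ℕ => 1 - 2 / (n : ℝ)) atTop (𝓝 (1 - 0)) :=
    tendsto_const_nhds.sub (tendsto_const_nhds.div_atTop tendsto_natCast_atTop_atTop)
  have h2 := ((hL.pow 2).add ((h1.pow 2).const_mul (2 * ℓ))).sqrt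
  have h3 := (h2.sub hL).sub (tendsto_const_div_log 1)
  simp only [sub_zero, one_pow, mul_one] at h3
  refine h3.congr' ?_
  filter_upwards [eventually_one_lt_log, eventually_gt_atTop 0] with n hn hn0
  have hn0' : (0 : ℝ) < n := by exact_mod_cast hn0
  have hl : 0 < Real.log n := by linarith
  rw [WeightedGraph.rate]
  set X := Real.log (c * (n : ℝ) ^ p * Real.exp (killRate ℓ n) / (Real.exp (killRate ℓ n) - 1))
  have e : (X / 2) ^ 2 + 2 * killRate ℓ n * ((n : ℝ) - 2) ^ 2 =
      (Real.log n) ^ 2 * ((X / Real.log n / 2) ^ 2 + 2 * ℓ * (1 - 2 / (n : ℝ)) ^ 2) := by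
    rw [killRate]; field_simp
  rw [e, Real.sqrt_mul (by positivity), Real.sqrt_sq hl.le]
  field_simp

theorem natCast_rpow_eq_exp {n : ℕ} (hn : 0 < n) (x : ℝ) :
    (n : ℝ) ^ x = Real.exp (Real.log n * x) :=
  Real.rpow_def_of_pos (by exact_mod_cast hn) x

/-- Asymptotic form of the universal bound for the Laplace transform. -/
theorem eventually_laplace_le {c p ℓ ε : ℝ} (hc : 0 < c) (hℓ : 0 < ℓ) (hε : 0 < ε) :
    ∀ᶠ n : ℕ in atTop, ∀ (V : Type u) (G : WeightedGraph V) (o : V) (z : Set V),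
      G.IsAdmissible c p n o z → ∀ N,
        G.laplace z (ENNReal.ofReal (Real.exp (-killRate ℓ n))) N o ≤
          ENNReal.ofReal ((n : ℝ) ^
            ((p + 2) / 2 - Real.sqrt (((p + 2) / 2) ^ 2 + 2 * ℓ) + ε)) := by
  have h := (tendsto_rate_div_log (p := p) hc hℓ).eventually_const_lt
    (show Real.sqrt (((p + 2) / 2) ^ 2 + 2 * ℓ) - (p + 2) / 2 - ε < _ by linarith)
  filter_upwards [h, eventually_one_lt_log, eventually_ge_atTop 2, eventually_killRate_pos hℓ]
    with n hn hlog hn2 hk V G o z hadm N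
  have hn0 : (0 : ℝ) < n := by exact_mod_cast (by lia : 0 < n)
  refine (G.laplace_le z o n hn2 hadm.pos hadm.le_dist (by positivity) hadm.weight_lt.le hk
    N).trans (ENNReal.ofReal_le_ofReal ?_)
  rw [natCast_rpow_eq_exp (by lia) (_ + ε)]
  apply Real.exp_le_exp.2
  rw [lt_div_iff₀ (by linarith)] at hn
  linarith

theorem WeightedGraph.IsAdmissible.notMem {V : Type u} {G : WeightedGraph V} {c p : ℝ} {n : ℕ}
    {o : V} {z : Set V} (h : G.IsAdmissible c p n o z) (hn : 0 < n) : o ∉ z := fun ho => by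
  have := G.cutDist_of_mem h.le_dist ho
  rw [WeightedGraph.cutDist_self] at this
  lia

theorem add_one_lt_of_mem_range {t : ℝ} {k : ℕ} (hk : k ∈ Finset.range (⌈t⌉₊ - 1)) :
    (k : ℝ) + 1 < t := by
  have h1 : k + 1 < ⌈t⌉₊ := by rw [Finset.mem_range] at hk; lia
  have := Nat.lt_ceil.1 h1
  exact_mod_cast this

/-- The exponential Chebyshev inequality. -/
theorem WeightedGraph.probHitBefore_le {V : Type u} (G : WeightedGraph V) [MeasurableSpace V]
    [DiscreteMeasurableSpace V] {o : V} {z : Set V} (ho : o ∉ z) (t : ℝ) {l : ℝ} (hl : 0 ≤ l) :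
    G.probHitBefore o z t ≤ ENNReal.ofReal (Real.exp (l * t)) *
      G.laplace z (ENNReal.ofReal (Real.exp (-l))) (⌈t⌉₊ - 1) o := by
  rw [G.probHitBefore_eq o z ho, laplace, Finset.mul_sum]
  refine Finset.sum_le_sum fun k hk => ?_
  rw [← mul_assoc, ← ENNReal.ofReal_pow (Real.exp_pos _).le, ← Real.exp_nat_mul,
    ← ENNReal.ofReal_mul (Real.exp_pos _).le, ← Real.exp_add]
  refine le_mul_of_one_le_left' ?_
  rw [← ENNReal.ofReal_one]
  apply ENNReal.ofReal_le_ofReal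
  rw [Real.one_le_exp_iff]
  have := add_one_lt_of_mem_range hk
  push_cast
  nlinarith

theorem eventually_probHitBefore_le {c p α ε : ℝ} (hc : 0 < c) (hp : -2 < p) (hα : 0 < α)
    (hα' : α < 2 / (p + 2)) (hε : 0 < ε) :
    ∀ᶠ n : ℕ in atTop, ∀ (V : Type u) (_ : MeasurableSpace V) (_ : DiscreteMeasurableSpace V)
      (G : WeightedGraph V) (o : V) (z : Set V), G.IsAdmissible c p n o z →
        G.probHitBefore o z (α * (n : ℝ) ^ 2 / Real.log n) ≤
          ENNReal.ofReal ((n : ℝ) ^ (-(α * (p + 2) - 2) ^ 2 / (8 * α) + ε)) := by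
  have hp2 : 0 < p + 2 := by linarith
  set q := (p + 2) / 2 with hq
  have hqα : q < 1 / α := by
    rw [lt_div_iff₀ hp2] at hα'
    rw [lt_div_iff₀ hα, hq]
    linarith
  have hq0 : 0 < q := by positivity
  -- The minimizer of the Chebyshev exponent `ℓ α + q - √(q^2 + 2ℓ)`, where the root equals `1 / α`.
  -- It is positive exactly because `α < 2 / (p + 2)`.
  set ℓ := ((1 / α) ^ 2 - q ^ 2) / 2 with hℓ
  have hℓ0 : 0 < ℓ := by
    have : q ^ 2 < (1 / α) ^ 2 := by gcongr
    rw [hℓ]; linarith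
  have hsqrt : Real.sqrt (q ^ 2 + 2 * ℓ) = 1 / α := by
    rw [show q ^ 2 + 2 * ℓ = (1 / α) ^ 2 by rw [hℓ]; ring, Real.sqrt_sq (by positivity)]
  filter_upwards [eventually_laplace_le.{u} (p := p) hc hℓ0 hε, eventually_one_lt_log,
    eventually_gt_atTop 0, eventually_killRate_pos hℓ0] with n h hlog hn0 hk V _ _ G o z hadm
  have hn0' : (0 : ℝ) < n := by exact_mod_cast hn0
  have hl : 0 < Real.log n := by linarith
  refine (G.probHitBefore_le (hadm.notMem hn0) _ hk.le).trans ?_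
  refine (mul_le_mul_right (h V G o z hadm _) _).trans ?_
  rw [← hq, hsqrt, ← ENNReal.ofReal_mul (Real.exp_pos _).le]
  apply ENNReal.ofReal_le_ofReal
  rw [natCast_rpow_eq_exp hn0, natCast_rpow_eq_exp hn0, ← Real.exp_add]
  apply Real.exp_le_exp.2
  apply le_of_eq
  rw [killRate, hℓ, hq]
  field_simp
  ring

theorem eventually_supProbHitSet_le {c p α ε : ℝ} (hc : 0 < c) (hp : -2 < p) (hα : 0 < α)
    (hα' : α < 2 / (p + 2)) (hε : 0 < ε) :
    ∀ᶠ n : ℕ in atTop, supProbHitSet.{u} c p n (α * (n : ℝ) ^ 2 / Real.log n) ≤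
      ENNReal.ofReal ((n : ℝ) ^ (-(α * (p + 2) - 2) ^ 2 / (8 * α) + ε)) := by
  filter_upwards [eventually_probHitBefore_le.{u} hc hp hα hα' hε] with n h
  simp only [supProbHitSet, iSup_le_iff]
  exact fun V _ _ G o z hadm => h V _ _ G o z hadm

/-- Below the critical `α` the probability of an early hit decays like a power of `n`, uniformly
over the admissible graphs. -/
theorem eventually_le_infExpectedHitSet {c p α δ : ℝ} (hc : 0 < c) (hp : -2 < p) (hα : 0 < α)
    (hα' : α < 2 / (p + 2)) (hδ : 0 < δ) :
    ∀ᶠ n : ℕ in atTop, ENNReal.ofReal (α * (n : ℝ) ^ 2 / Real.log n * (1 - δ)) ≤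
      infExpectedHitSet.{u} c p n := by
  have hp2 : 0 < p + 2 := by linarith
  set E := (α * (p + 2) - 2) ^ 2 / (8 * α) with hE
  have hE0 : 0 < E := by
    have : α * (p + 2) - 2 < 0 := by rw [lt_div_iff₀ hp2] at hα'; linarith
    have : 0 < (α * (p + 2) - 2) ^ 2 := sq_pos_of_neg this
    positivity
  have htend : Tendsto (fun n : ℕ => (n : ℝ) ^ (-(E / 2))) atTop (𝓝 0) :=
    (tendsto_rpow_neg_atTop (by positivity)).comp tendsto_natCast_atTop_atTop
  filter_upwards [eventually_probHitBefore_le.{u} hc hp hα hα' (half_pos hE0),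
    htend.eventually_lt_const hδ, eventually_one_lt_log] with n h hδn hlog
  simp only [infExpectedHitSet, le_iInf_iff]
  intro V _ _ G o z hadm
  refine le_trans ?_ (G.ofReal_mul_le_expectedHit o z (α * (n : ℝ) ^ 2 / Real.log n))
  have hl : 0 < Real.log n := by linarith
  rw [ENNReal.ofReal_mul (by positivity)]
  gcongr
  rw [ENNReal.ofReal_sub _ hδ.le, ENNReal.ofReal_one]
  gcongr
  refine (h V _ _ G o z hadm).trans (ENNReal.ofReal_le_ofReal ?_)
  rw [show -(α * (p + 2) - 2) ^ 2 / (8 * α) + E / 2 = -(E / 2) by rw [hE]; ring]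
  exact hδn.le

/-! ### Comparison principles for specific graphs. -/

namespace WeightedGraph

section Comparison

variable {V : Type u} (G : WeightedGraph V)

theorem killed_le_stepMean (z : Set V) {f g : V → ℝ≥0∞} (h : ∀ x ∉ z, f x ≤ g x) :
    G.killed z f ≤ G.stepMean g :=
  G.stepMean_mono fun x => by
    by_cases hx : x ∈ z
    · simp [hx]
    · simpa [hx] using h x hx

/-- A supersolution dominates the expected hitting time. -/
theorem tsum_killed_le (z : Set V) (v : V → ℝ≥0∞) (hv : ∀ x ∉ z, 1 + G.stepMean v x ≤ v x)
    {o : V} (ho : o ∉ z) : ∑' k, (G.killed z)^[k] 1 o ≤ v o := by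
  refine ENNReal.tsum_le_of_sum_range_le fun N => ?_
  induction N generalizing o with
  | zero => simp
  | succ N ih =>
    have h : ∑ k ∈ Finset.range N, (G.killed z)^[k + 1] 1 o =
        G.killed z (fun y => ∑ k ∈ Finset.range N, 1 * (G.killed z)^[k] 1 y) o := by
      rw [G.killed_sum]
      simp only [one_mul, Function.iterate_succ_apply']
    rw [Finset.sum_range_succ', h, add_comm]
    refine le_trans (add_le_add le_rfl ?_) (hv o ho)
    exact G.killed_le_stepMean z (fun x hx => by simpa using ih hx) o

theorem stepMean_one (x : V) : G.stepMean 1 x = 1 := by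
  simp [stepMean, PMF.tsum_coe]

theorem stepMean_add_const_mul (f g : V → ℝ≥0∞) (a : ℝ≥0∞) (x : V) :
    G.stepMean (fun y => f y + a * g y) x = G.stepMean f x + a * G.stepMean g x := by
  simp only [stepMean, ← ENNReal.tsum_mul_left, ← ENNReal.tsum_add]
  exact tsum_congr fun y => by ring

/-- A subsolution is dominated by the Laplace transform of the hitting time. -/
theorem le_laplace_add_pow (z : Set V) (γ : ℝ≥0∞) (φ : V → ℝ≥0∞) (hφ1 : ∀ x, φ x ≤ 1)
    (hφ : ∀ x ∉ z, φ x ≤ γ * G.stepMean φ x) (N : ℕ) {o : V} (ho : o ∉ z) :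
    φ o ≤ G.laplace z γ N o + γ ^ N := by
  induction N generalizing o with
  | zero => simpa using le_add_left (hφ1 o)
  | succ N ih =>
    have h1 : G.stepMean φ o ≤ G.stepMean (fun y => (z.indicator 1 y +
        1 * zᶜ.indicator (G.laplace z γ N) y) + γ ^ N * (1 : V → ℝ≥0∞) y) o := by
      refine G.stepMean_mono (fun y => ?_) o
      by_cases hy : y ∈ z
      · simpa [hy] using (hφ1 y).trans le_self_add
      · simpa [hy] using ih hy
    rw [stepMean_add_const_mul, stepMean_add_const_mul, stepMean_one, one_mul, mul_one] at h1
    calc φ o ≤ γ * G.stepMean φ o := hφ o ho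
      _ ≤ γ * (G.stepMean (z.indicator 1) o + G.stepMean (zᶜ.indicator (G.laplace z γ N)) o +
            γ ^ N) := by gcongr
      _ = _ := by rw [laplace_succ, killed, pow_succ']; ring

theorem le_iSup_laplace (z : Set V) {γ : ℝ≥0∞} (hγ : γ < 1) (φ : V → ℝ≥0∞) (hφ1 : ∀ x, φ x ≤ 1)
    (hφ : ∀ x ∉ z, φ x ≤ γ * G.stepMean φ x) {o : V} (ho : o ∉ z) :
    φ o ≤ ⨆ N, G.laplace z γ N o := by
  have h1 : Tendsto (fun N : ℕ => (⨆ N, G.laplace z γ N o) + γ ^ N) atTop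
      (𝓝 ((⨆ N, G.laplace z γ N o) + 0)) :=
    tendsto_const_nhds.add (ENNReal.tendsto_pow_atTop_nhds_zero_of_lt_one hγ)
  rw [add_zero] at h1
  refine ge_of_tendsto' h1 fun N => (G.le_laplace_add_pow z γ φ hφ1 hφ N ho).trans ?_
  gcongr
  exact le_iSup (fun N => G.laplace z γ N o) N

theorem le_distTo {o : V} {z : Set V} {n : ℕ} (f : V → ℕ) (ho : f o = 0) (hz : ∀ x ∈ z, f x = n)
    (hf : ∀ x y, G.w x y ≠ 0 → f y ≤ f x + 1) : (n : ℕ∞) ≤ G.distTo o z := by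
  have hwalk : ∀ x y (p : G.support.Walk x y), f y ≤ f x + p.length := by
    intro x y p
    induction p with
    | nil => simp
    | cons h p ih =>
      have := hf _ _ h.2
      rw [SimpleGraph.Walk.length_cons]
      lia
  refine le_iInf₂ fun x hx => ?_
  rw [← hz x hx]
  by_cases htop : G.support.edist o x = ⊤
  · rw [htop]; exact le_top
  · obtain ⟨p, hp⟩ := SimpleGraph.exists_walk_of_edist_ne_top htop
    rw [← hp]
    have := hwalk o x p
    rw [ho, zero_add] at this
    exact_mod_cast this

/-- The large deviations lower bound from the Laplace transform at three parameters. -/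
theorem laplace_le_three [MeasurableSpace V] [DiscreteMeasurableSpace V] {o : V} {z : Set V}
    (ho : o ∉ z) {l ϑ s t : ℝ} (hl : 0 ≤ l) (hϑ : 0 ≤ ϑ) (N : ℕ) :
    G.laplace z (ENNReal.ofReal (Real.exp (-l))) N o ≤
      ENNReal.ofReal (Real.exp (ϑ * s)) *
          G.laplace z (ENNReal.ofReal (Real.exp (-(l + ϑ)))) N o +
        ENNReal.ofReal (Real.exp (-l * s)) * G.probHitBefore o z t +
        ENNReal.ofReal (Real.exp (-ϑ * t)) *
          G.laplace z (ENNReal.ofReal (Real.exp (-(l - ϑ)))) N o := by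
  have hprob : ∑ k ∈ (Finset.range N).filter (fun k : ℕ => (k : ℝ) + 1 < t), G.hitAt z k o ≤
      G.probHitBefore o z t := by
    rw [G.probHitBefore_eq o z ho]
    refine Finset.sum_le_sum_of_subset fun k hk => ?_
    rw [Finset.mem_filter] at hk
    have h1 : k + 1 < ⌈t⌉₊ := Nat.lt_ceil.2 (by exact_mod_cast hk.2)
    rw [Finset.mem_range]
    lia
  refine le_trans ?_ (add_le_add_left (add_le_add_right (mul_le_mul_right hprob _) _) _)
  simp only [laplace]
  rw [Finset.mul_sum, Finset.mul_sum, Finset.mul_sum, Finset.sum_filter, ← Finset.sum_add_distrib,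
    ← Finset.sum_add_distrib]
  refine Finset.sum_le_sum fun k _ => ?_
  simp only [← ENNReal.ofReal_pow (Real.exp_pos _).le, ← Real.exp_nat_mul, ← mul_assoc,
    ← ENNReal.ofReal_mul (Real.exp_pos _).le, ← Real.exp_add]
  -- Hitting times up to `s` are charged to the larger parameter `l + ϑ`, times from `t` on to the
  -- smaller `l - ϑ`, and those in between to the probability.
  by_cases h1 : (k : ℝ) + 1 ≤ s
  · refine le_trans ?_ (le_self_add.trans le_self_add)
    gcongr
    push_cast
    nlinarith
  by_cases h2 : (k : ℝ) + 1 < t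
  · rw [if_pos h2]
    refine le_trans ?_ (le_add_self.trans le_self_add)
    refine mul_le_mul_left (ENNReal.ofReal_le_ofReal (Real.exp_le_exp.2 ?_)) _
    push_cast
    push Not at h1
    nlinarith
  · refine le_trans ?_ le_add_self
    gcongr
    push_cast
    push Not at h2
    nlinarith

end Comparison

/-! ### The fast path. -/

section Path

/-- The weights of a path on `ℕ` with a loop of weight `K` at `0`. -/
def pathWeight (e : ℕ → ℝ≥0) (K : ℝ≥0) (i j : ℕ) : ℝ≥0 :=
  if j = i + 1 then e i else if i = j + 1 then e j else if i = 0 ∧ j = 0 then K else 0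

theorem pathWeight_symm (e : ℕ → ℝ≥0) (K : ℝ≥0) (i j : ℕ) :
    pathWeight e K i j = pathWeight e K j i := by
  unfold pathWeight
  split_ifs <;> first | rfl | lia

theorem tsum_uLift (f : ULift.{u} ℕ → ℝ≥0∞) : ∑' y, f y = ∑' j : ℕ, f ⟨j⟩ :=
  (Equiv.ulift.symm.tsum_eq f).symm

theorem tsum_pathWeight_zero (e : ℕ → ℝ≥0) (K : ℝ≥0) (f : ℕ → ℝ≥0∞) :
    ∑' j, (pathWeight e K 0 j : ℝ≥0∞) * f j = K * f 0 + e 0 * f 1 := by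
  rw [tsum_eq_sum (s := {0, 1}), Finset.sum_pair (by simp)]
  · simp [pathWeight]
  · intro j hj
    simp only [Finset.mem_insert, Finset.mem_singleton, not_or] at hj
    simp [pathWeight, hj.1, hj.2]

theorem tsum_pathWeight_succ (e : ℕ → ℝ≥0) (K : ℝ≥0) (f : ℕ → ℝ≥0∞) (i : ℕ) :
    ∑' j, (pathWeight e K (i + 1) j : ℝ≥0∞) * f j = e i * f i + e (i + 1) * f (i + 2) := by
  rw [tsum_eq_sum (s := {i, i + 2}), Finset.sum_pair (by simp)]
  · have h : i ≠ i + 1 + 1 := by lia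
    simp [pathWeight, h]
  · intro j hj
    simp only [Finset.mem_insert, Finset.mem_singleton, not_or] at hj
    have h1 : ¬ j = i + 1 + 1 := by lia
    have h2 : ¬ i = j := by lia
    simp [pathWeight, h1, h2]

/-- The weighted path on `ℕ` with a loop at `0`. -/
def path (e : ℕ → ℝ≥0) (K : ℝ≥0) : WeightedGraph (ULift.{u} ℕ) where
  w x y := pathWeight e K x.down y.down
  symm x y := pathWeight_symm e K x.down y.down
  tsum_ne_top x := by
    rw [tsum_uLift]
    rcases x with ⟨_ | i⟩
    · have := tsum_pathWeight_zero e K 1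
      simp only [Pi.one_apply, mul_one] at this
      rw [this, ← ENNReal.coe_add]
      exact ENNReal.coe_ne_top
    · have := tsum_pathWeight_succ e K 1 i
      simp only [Pi.one_apply, mul_one] at this
      rw [this, ← ENNReal.coe_add]
      exact ENNReal.coe_ne_top

variable (e : ℕ → ℝ≥0) (K : ℝ≥0)

theorem path_vertexWeight_zero : (path.{u} e K).vertexWeight ⟨0⟩ = K + e 0 := by
  have := tsum_pathWeight_zero e K 1
  simp only [Pi.one_apply, mul_one] at this
  rw [vertexWeight, tsum_uLift]
  exact this

theorem path_vertexWeight_succ (i : ℕ) :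
    (path.{u} e K).vertexWeight ⟨i + 1⟩ = e i + e (i + 1) := by
  have := tsum_pathWeight_succ e K 1 i
  simp only [Pi.one_apply, mul_one] at this
  rw [vertexWeight, tsum_uLift]
  exact this

theorem path_stepMean_zero (f : ULift.{u} ℕ → ℝ≥0∞) (h : K + e 0 ≠ 0) :
    (path e K).stepMean f ⟨0⟩ = (K * f ⟨0⟩ + e 0 * f ⟨1⟩) * ((K : ℝ≥0∞) + e 0)⁻¹ := by
  have hw : (path.{u} e K).vertexWeight ⟨0⟩ ≠ 0 := by
    rw [path_vertexWeight_zero]; exact_mod_cast h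
  simp only [stepMean, step_apply _ hw]
  rw [path_vertexWeight_zero, tsum_uLift, ← tsum_pathWeight_zero e K (fun j => f ⟨j⟩),
    ← ENNReal.tsum_mul_right]
  exact tsum_congr fun j => by simp only [path]; ring

theorem path_stepMean_succ (f : ULift.{u} ℕ → ℝ≥0∞) (i : ℕ) (h : e i + e (i + 1) ≠ 0) :
    (path e K).stepMean f ⟨i + 1⟩ =
      (e i * f ⟨i⟩ + e (i + 1) * f ⟨i + 2⟩) * ((e i : ℝ≥0∞) + e (i + 1))⁻¹ := by
  have hw : (path.{u} e K).vertexWeight ⟨i + 1⟩ ≠ 0 := by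
    rw [path_vertexWeight_succ]; exact_mod_cast h
  simp only [stepMean, step_apply _ hw]
  rw [path_vertexWeight_succ, tsum_uLift, ← tsum_pathWeight_succ e K (fun j => f ⟨j⟩),
    ← ENNReal.tsum_mul_right]
  exact tsum_congr fun j => by simp only [path]; ring

theorem path_le_distTo (n : ℕ) : (n : ℕ∞) ≤ (path.{u} e K).distTo ⟨0⟩ {⟨n⟩} := by
  refine le_distTo _ ULift.down rfl (by simp) fun x y hxy => ?_
  simp only [path, pathWeight] at hxy
  split_ifs at hxy with h1 h2 h3
  · lia
  · lia
  · lia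
  · exact absurd rfl hxy

theorem weighted_mean_eq {a b : ℝ≥0} (hab : a + b ≠ 0) {x y : ℝ} (hx : 0 ≤ x) (hy : 0 ≤ y) :
    (a * ENNReal.ofReal x + b * ENNReal.ofReal y) * ((a : ℝ≥0∞) + b)⁻¹ =
      ENNReal.ofReal ((a * x + b * y) / (a + b)) := by
  have hpos : (0 : ℝ) < a + b := by exact_mod_cast pos_iff_ne_zero.2 hab
  rw [ENNReal.ofReal_div_of_pos hpos, ENNReal.ofReal_add (by positivity) (by positivity),
    ENNReal.ofReal_mul (by positivity), ENNReal.ofReal_mul (by positivity),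
    ENNReal.ofReal_add (by positivity) (by positivity), ENNReal.ofReal_coe_nnreal,
    ENNReal.ofReal_coe_nnreal, div_eq_mul_inv]

theorem one_add_weighted_mean_le {a b : ℝ≥0} (hab : a + b ≠ 0) {x y v : ℝ} (hx : 0 ≤ x)
    (hy : 0 ≤ y) (h : a + b + (a * x + b * y) ≤ (a + b) * v) :
    1 + (a * ENNReal.ofReal x + b * ENNReal.ofReal y) * ((a : ℝ≥0∞) + b)⁻¹ ≤ ENNReal.ofReal v := by
  have hpos : (0 : ℝ) < a + b := by exact_mod_cast pos_iff_ne_zero.2 hab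
  rw [weighted_mean_eq hab hx hy, ← ENNReal.ofReal_one, ← ENNReal.ofReal_add zero_le_one
    (by positivity)]
  apply ENNReal.ofReal_le_ofReal
  rw [← sub_nonneg] at h ⊢
  have e : v - (1 + (a * x + b * y) / (a + b)) =
      ((a + b) * v - (a + b + (a * x + b * y))) / (a + b) := by field_simp
  rw [e]
  exact div_nonneg h hpos.le

theorem le_mul_weighted_mean {a b : ℝ≥0} (hab : a + b ≠ 0) {x y v l : ℝ} (hx : 0 ≤ x)
    (hy : 0 ≤ y) (h : Real.exp l * ((a + b) * v) ≤ a * x + b * y) :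
    ENNReal.ofReal v ≤ ENNReal.ofReal (Real.exp (-l)) *
      ((a * ENNReal.ofReal x + b * ENNReal.ofReal y) * ((a : ℝ≥0∞) + b)⁻¹) := by
  have hpos : (0 : ℝ) < a + b := by exact_mod_cast pos_iff_ne_zero.2 hab
  rw [weighted_mean_eq hab hx hy, ← ENNReal.ofReal_mul (Real.exp_pos _).le]
  apply ENNReal.ofReal_le_ofReal
  rw [Real.exp_neg, inv_mul_eq_div, div_div, le_div_iff₀ (by positivity)]
  linarith

/-- The edge weights `1, ρ, ρ ^ 2, …, ρ ^ (n - 2), η` of the fast path of length `n`. -/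
def fastEdge (ρ η : ℝ≥0) (n i : ℕ) : ℝ≥0 :=
  if i + 1 < n then ρ ^ i else if i + 1 = n then η else 0

variable {ρ η K : ℝ≥0} {n : ℕ}

theorem fastEdge_of_lt {i : ℕ} (h : i + 1 < n) : fastEdge ρ η n i = ρ ^ i := if_pos h

theorem fastEdge_last {i : ℕ} (h : i + 1 = n) : fastEdge ρ η n i = η := by
  rw [fastEdge, if_neg (by lia), if_pos h]

theorem fastEdge_of_ge {i : ℕ} (h : n ≤ i) : fastEdge ρ η n i = 0 := by
  rw [fastEdge, if_neg (by lia), if_neg (by lia)]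

/-- The increments of a supersolution for the expected hitting time on the fast path. -/
noncomputable def fastIncr (ρ η K : ℝ) (n i : ℕ) : ℝ :=
  if i + 1 < n then K / ρ ^ i + (ρ + 1) / (ρ - 1)
  else 1 + (K + ρ ^ (n - 2) * ((ρ + 1) / (ρ - 1) + 1)) / η

theorem fastIncr_nonneg (hρ : 1 < ρ) (i : ℕ) : 0 ≤ fastIncr ρ η K n i := by
  have h1 : (0 : ℝ) < ρ - 1 := by have : (1 : ℝ) < ρ := by exact_mod_cast hρ
                                  linarith
  unfold fastIncr
  split_ifs <;> positivity

/-- For a decreasing function with decrements `D`, being a supersolution at `x > 0` means that `e x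
* D x` exceeds `e (x - 1) * D (x - 1)` by at least the weight of `x`. `fastIncr` attains equality at
`0 < x < n`, and at 0 the requirement is `D 0 ≥ K + 1`. -/
theorem fast_expectedHit_le (hn : 2 ≤ n) (hρ : 1 < ρ) (hη : 0 < η) :
    (path.{u} (fastEdge ρ η n) K).expectedHit ⟨0⟩ {⟨n⟩} ≤
      ENNReal.ofReal (∑ i ∈ Finset.Ico 0 n, fastIncr ρ η K n i) := by
  have hρ' : (1 : ℝ) < ρ := by exact_mod_cast hρ
  have hη' : (0 : ℝ) < η := by exact_mod_cast hη
  have hρ1 : (0 : ℝ) < ρ - 1 := by linarith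
  have h0 : (⟨0⟩ : ULift.{u} ℕ) ∉ ({⟨n⟩} : Set (ULift.{u} ℕ)) := by
    simp only [Set.mem_singleton_iff, ULift.up.injEq]; lia
  refine (expectedHit_le_tsum _ _ _ h0).trans ?_
  let v : ℕ → ℝ := fun x => ∑ i ∈ Finset.Ico x n, fastIncr ρ η K n i
  have hv0 : ∀ x, 0 ≤ v x := fun x => Finset.sum_nonneg fun i _ => fastIncr_nonneg hρ i
  have hvs : ∀ x, x < n → v x = fastIncr ρ η K n x + v (x + 1) := fun x hx =>
    Finset.sum_eq_sum_Ico_succ_bot hx _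
  -- The value `⊤` beyond `n` makes the inequality trivial at the unused vertices.
  let F : ULift.{u} ℕ → ℝ≥0∞ := fun x => if x.down ≤ n then ENNReal.ofReal (v x.down) else ⊤
  have hF : ∀ i, i ≤ n → F ⟨i⟩ = ENNReal.ofReal (v i) := fun i hi => if_pos hi
  have hF0 : F ⟨0⟩ = ENNReal.ofReal (v 0) := hF 0 (by lia)
  change _ ≤ ENNReal.ofReal (v 0)
  rw [← hF0]
  refine tsum_killed_le _ _ F ?_ h0
  rintro ⟨x⟩ hx
  have hxn : x ≠ n := by simpa using hx
  rcases lt_or_gt_of_ne hxn with hlt | hgt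
  · rw [hF x hlt.le]
    rcases x with _ | j
    · have he : fastEdge ρ η n 0 = 1 := by rw [fastEdge_of_lt (by lia), pow_zero]
      have hne : K + fastEdge ρ η n 0 ≠ 0 := by rw [he]; positivity
      rw [path_stepMean_zero _ _ _ hne, hF 0 (by lia), hF 1 (by lia)]
      refine one_add_weighted_mean_le hne (hv0 _) (hv0 _) ?_
      rw [he, hvs 0 hlt, fastIncr, if_pos (by lia)]
      have : 1 ≤ ((ρ : ℝ) + 1) / (ρ - 1) := by rw [le_div_iff₀ hρ1]; linarith
      push_cast
      simp only [pow_zero, div_one]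
      linarith
    · have hea : fastEdge ρ η n j = ρ ^ j := fastEdge_of_lt (by lia)
      have hρj : (0 : ℝ) < (ρ : ℝ) ^ j := by positivity
      have hne : fastEdge ρ η n j + fastEdge ρ η n (j + 1) ≠ 0 := by
        rw [hea]
        have : 0 < ρ ^ j := pow_pos (one_pos.trans hρ) j
        positivity
      rw [path_stepMean_succ _ _ _ _ hne, hF j (by lia), hF (j + 2) (by lia)]
      refine one_add_weighted_mean_le hne (hv0 _) (hv0 _) ?_
      rw [hvs j (by lia), hvs (j + 1) hlt, hea]
      set b : ℝ := ((fastEdge ρ η n (j + 1) : ℝ≥0) : ℝ)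
      suffices h : (ρ : ℝ) ^ j + b + ρ ^ j * fastIncr ρ η K n j ≤
          b * fastIncr ρ η K n (j + 1) by
        push_cast
        linarith
      have hD : fastIncr ρ η K n j = K / ρ ^ j + (ρ + 1) / (ρ - 1) := if_pos (by lia)
      have hDj : (ρ : ℝ) ^ j * fastIncr ρ η K n j = K + ρ ^ j * ((ρ + 1) / (ρ - 1)) := by
        rw [hD]; field_simp
      rw [hDj]
      by_cases hj : j + 1 + 1 < n
      · have hb : b = ρ ^ (j + 1) := by simp only [b]; rw [fastEdge_of_lt hj]; push_cast; rfl
        have hD2 : fastIncr ρ η K n (j + 1) = K / ρ ^ (j + 1) + (ρ + 1) / (ρ - 1) := if_pos hj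
        rw [hb, hD2]
        apply le_of_eq
        field_simp
        ring
      · have hjn : j + 1 + 1 = n := by lia
        have hb : b = η := by simp only [b]; rw [fastEdge_last hjn]
        have hD2 : fastIncr ρ η K n (j + 1) =
            1 + (K + ρ ^ (n - 2) * ((ρ + 1) / (ρ - 1) + 1)) / η := if_neg hj
        rw [hb, hD2, show n - 2 = j by lia, mul_add, mul_div_cancel₀ _ hη'.ne']
        linarith
  · have : F ⟨x⟩ = ⊤ := if_neg (by simpa using hgt)
    rw [this]
    exact le_top

theorem sum_fastIncr_le (hn : 2 ≤ n) (hρ : 1 < ρ) :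
    ∑ i ∈ Finset.Ico 0 n, fastIncr ρ η K n i ≤
      K * (ρ / (ρ - 1)) + n * ((ρ + 1) / (ρ - 1)) +
        (1 + (K + ρ ^ (n - 2) * ((ρ + 1) / (ρ - 1) + 1)) / η) := by
  have hρ' : (1 : ℝ) < ρ := by exact_mod_cast hρ
  have hρ1 : (0 : ℝ) < ρ - 1 := by linarith
  obtain ⟨k, rfl⟩ : ∃ k, n = k + 1 := ⟨n - 1, by lia⟩
  rw [Finset.sum_Ico_succ_top (by lia)]
  refine add_le_add ?_ (le_of_eq (if_neg (by lia)))
  rw [← Finset.range_eq_Ico]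
  have h1 : ∑ i ∈ Finset.range k, fastIncr ρ η K (k + 1) i =
      ∑ i ∈ Finset.range k, ((K : ℝ) * (ρ : ℝ)⁻¹ ^ i + (ρ + 1) / (ρ - 1)) := by
    refine Finset.sum_congr rfl fun i hi => ?_
    rw [fastIncr, if_pos (by rw [Finset.mem_range] at hi; lia), inv_pow]
    rfl
  rw [h1, Finset.sum_add_distrib, ← Finset.mul_sum]
  refine add_le_add ?_ ?_
  · gcongr
    rw [geom_sum_eq (inv_lt_one_of_one_lt₀ hρ').ne]
    have h2 : (0 : ℝ) ≤ (ρ : ℝ)⁻¹ ^ k := by positivity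
    have e : (((ρ : ℝ)⁻¹ ^ k - 1) / ((ρ : ℝ)⁻¹ - 1)) =
        (1 - (ρ : ℝ)⁻¹ ^ k) * (ρ / (ρ - 1)) := by
      rw [div_eq_iff (by have := inv_lt_one_of_one_lt₀ hρ'; linarith)]
      field_simp
      ring
    rw [e]
    exact mul_le_of_le_one_left (by positivity) (by linarith)
  · simp only [Finset.sum_const, Finset.card_range, nsmul_eq_mul]
    have : 0 ≤ ((ρ : ℝ) + 1) / (ρ - 1) := by positivity
    push_cast
    nlinarith

/-- A geometric function of ratio `s` is a subsolution: `hmid`, `hstart` and `hend` are the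
inequality at the inner vertices, at 0 and at `n - 1`. The factor `1 / 2` leaves a jump up to 1 at
the target, which compensates for the weak last edge. -/
theorem fast_le_laplace (hn : 2 ≤ n) (hρ : 1 < ρ) {s l : ℝ} (hs : 1 < s) (hl : 0 < l)
    (hmid : Real.exp l * (1 + ρ) ≤ ρ * s + s⁻¹)
    (hstart : (Real.exp l - 1) * (K + 1) ≤ s - 1)
    (hend : Real.exp l * ((ρ ^ (n - 2) + η) * (1 / 2)) ≤ ρ ^ (n - 2) * (1 / 2 * s⁻¹) + η) :
    ENNReal.ofReal (1 / 2 * (s ^ (n - 1))⁻¹) ≤ ⨆ N,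
      (path.{u} (fastEdge ρ η n) K).laplace {⟨n⟩} (ENNReal.ofReal (Real.exp (-l))) N ⟨0⟩ := by
  have hρ' : (1 : ℝ) < ρ := by exact_mod_cast hρ
  have hs0 : 0 < s := by linarith
  have h0 : (⟨0⟩ : ULift.{u} ℕ) ∉ ({⟨n⟩} : Set (ULift.{u} ℕ)) := by
    simp only [Set.mem_singleton_iff, ULift.up.injEq]; lia
  let φ : ℕ → ℝ := fun i => if i < n then 1 / 2 * (s ^ (n - 1 - i))⁻¹ else if i = n then 1 else 0
  have hφlt : ∀ i, i < n → φ i = 1 / 2 * (s ^ (n - 1 - i))⁻¹ := fun i hi => if_pos hi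
  have hφn : φ n = 1 := by simp [φ]
  have hφ0 : ∀ i, 0 ≤ φ i := fun i => by simp only [φ]; split_ifs <;> positivity
  have hφ1 : ∀ i, φ i ≤ 1 := fun i => by
    simp only [φ]
    split_ifs
    · have := inv_le_one_of_one_le₀ (one_le_pow₀ hs.le (n := n - 1 - i))
      linarith
    · exact le_rfl
    · exact zero_le_one
  have hφs : ∀ i, i + 1 < n → φ (i + 1) = s * φ i := fun i hi => by
    rw [hφlt i (by lia), hφlt (i + 1) hi, show n - 1 - i = (n - 1 - (i + 1)) + 1 by lia, pow_succ]
    field_simp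
  have hγ : ENNReal.ofReal (Real.exp (-l)) < 1 := by
    rw [← ENNReal.ofReal_one]
    exact (ENNReal.ofReal_lt_ofReal_iff one_pos).2 (Real.exp_lt_one_iff.2 (by linarith))
  have hmain := le_iSup_laplace (path.{u} (fastEdge ρ η n) K) {⟨n⟩} hγ
    (fun x => ENNReal.ofReal (φ x.down)) (fun x => by
      rw [← ENNReal.ofReal_one]; exact ENNReal.ofReal_le_ofReal (hφ1 _)) (o := ⟨0⟩) ?_ h0
  · have e : φ 0 = 1 / 2 * (s ^ (n - 1))⁻¹ := by rw [hφlt 0 (by lia)]; rfl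
    rw [← e]
    exact hmain
  rintro ⟨x⟩ hx
  have hxn : x ≠ n := by simpa using hx
  rcases lt_or_gt_of_ne hxn with hlt | hgt
  · rcases x with _ | j
    · have he : fastEdge ρ η n 0 = 1 := by rw [fastEdge_of_lt (by lia), pow_zero]
      have hne : K + fastEdge ρ η n 0 ≠ 0 := by rw [he]; positivity
      rw [path_stepMean_zero _ _ _ hne]
      refine le_mul_weighted_mean hne (hφ0 _) (hφ0 _) ?_
      rw [he, hφs 0 (by lia)]
      push_cast
      have := mul_le_mul_of_nonneg_right hstart (hφ0 0)
      linarith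
    · have hea : fastEdge ρ η n j = ρ ^ j := fastEdge_of_lt (by lia)
      have hρj : (0 : ℝ) < (ρ : ℝ) ^ j := by positivity
      have hne : fastEdge ρ η n j + fastEdge ρ η n (j + 1) ≠ 0 := by
        rw [hea]
        have : 0 < ρ ^ j := pow_pos (one_pos.trans hρ) j
        positivity
      rw [path_stepMean_succ _ _ _ _ hne]
      refine le_mul_weighted_mean hne (hφ0 _) (hφ0 _) ?_
      by_cases hj : j + 1 + 1 < n
      · rw [hea, fastEdge_of_lt hj]
        change _ ≤ _ * φ j + _ * φ (j + 1 + 1)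
        rw [hφs (j + 1) hj, hφs j (by lia)]
        have h1 := mul_le_mul_of_nonneg_left hmid
          (mul_nonneg hρj.le (mul_nonneg hs0.le (hφ0 j)))
        push_cast
        calc Real.exp l * (((ρ : ℝ) ^ j + ρ ^ (j + 1)) * (s * φ j)) =
              ρ ^ j * (s * φ j) * (Real.exp l * (1 + ρ)) := by ring
          _ ≤ _ := h1
          _ = _ := by field_simp; ring
      · have hjn : j + 1 + 1 = n := by lia
        rw [hea, fastEdge_last hjn]
        change _ ≤ _ * φ j + _ * φ (j + 1 + 1)
        rw [hjn, hφn, hφlt j (by lia), hφlt (j + 1) hlt, show n - 1 - (j + 1) = 0 by lia,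
          show n - 1 - j = 1 by lia]
        rw [show n - 2 = j by lia] at hend
        push_cast
        simpa using hend
  · have : φ x = 0 := by simp only [φ]; rw [if_neg (by lia), if_neg hxn]
    simp [this]

theorem fast_isAdmissible {c p : ℝ} (hn : 2 ≤ n)
    (h : (η : ℝ) < c * (n : ℝ) ^ p * (K + 1)) :
    (path.{u} (fastEdge ρ η n) K).IsAdmissible c p n ⟨0⟩ {⟨n⟩} := by
  have h0 : (path.{u} (fastEdge ρ η n) K).vertexWeight ⟨0⟩ = ((K + 1 : ℝ≥0) : ℝ≥0∞) := by
    rw [path_vertexWeight_zero, fastEdge_of_lt (by lia), pow_zero]; push_cast; rfl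
  refine ⟨?_, path_le_distTo _ _ n, ?_⟩
  · rw [h0]; exact_mod_cast (by positivity : (0 : ℝ≥0) < K + 1)
  · have h1 : (path.{u} (fastEdge ρ η n) K).setWeight {⟨n⟩} = η := by
      rw [setWeight, tsum_singleton]
      obtain ⟨k, rfl⟩ : ∃ k, n = k + 1 := ⟨n - 1, by lia⟩
      rw [path_vertexWeight_succ, fastEdge_last rfl, fastEdge_of_ge le_rfl]
      simp
    have hpos : (0 : ℝ) < K + 1 := by positivity
    have hK : (((K + 1 : ℝ≥0)) : ℝ) = K + 1 := by push_cast; rfl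
    rw [h0, h1, ← ENNReal.ofReal_coe_nnreal, ← ENNReal.ofReal_coe_nnreal, hK,
      ← ENNReal.ofReal_div_of_pos hpos]
    have h2 : (η : ℝ) / (K + 1) < c * (n : ℝ) ^ p := by rw [div_lt_iff₀ hpos]; exact h
    exact (ENNReal.ofReal_lt_ofReal_iff_of_nonneg (by positivity)).2 h2

end Path

end WeightedGraph

/-! ### Asymptotics of the fast path. -/

/-- The drift of the fast path: `ρ = 1 + fastDrift p n` satisfies `ρ ^ n ≤ n ^ (p + 2) / log n ^ 5`. -/
noncomputable def fastDrift (p : ℝ) (n : ℕ) : ℝ :=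
  ((p + 2) * Real.log n - 5 * Real.log (Real.log n)) / n

/-- The fast path of length `n`. -/
noncomputable def fastGraph (p : ℝ) (n : ℕ) : WeightedGraph (ULift.{u} ℕ) :=
  WeightedGraph.path (WeightedGraph.fastEdge (Real.toNNReal (1 + fastDrift p n))
    (Real.toNNReal ((1 + fastDrift p n) ^ (n - 2) * (Real.log n ^ 2 / n))) n)
    (Real.toNNReal (n / Real.log n ^ 2))

theorem tendsto_fastDrift_div (p : ℝ) :
    Tendsto (fun n : ℕ => fastDrift p n / (Real.log n / n)) atTop (𝓝 (p + 2)) := by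
  have h := (tendsto_log_log_div_log.const_mul 5).const_sub (p + 2)
  rw [mul_zero, sub_zero] at h
  refine h.congr' ?_
  filter_upwards [eventually_one_lt_log, eventually_gt_atTop 0] with n hlog hn
  have hn' : (0 : ℝ) < n := by exact_mod_cast hn
  have hl : 0 < Real.log n := by linarith
  rw [fastDrift]
  field_simp

theorem tendsto_fastDrift (p : ℝ) : Tendsto (fastDrift p) atTop (𝓝 0) := by
  have h := (tendsto_fastDrift_div p).mul tendsto_log_div_natCast
  rw [mul_zero] at h
  refine h.congr' ?_
  filter_upwards [eventually_one_lt_log, eventually_gt_atTop 0] with n hlog hn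
  have hn' : (0 : ℝ) < n := by exact_mod_cast hn
  have hl : 0 < Real.log n := by linarith
  field_simp

theorem eventually_fastDrift_pos {p : ℝ} (hp : -2 < p) : ∀ᶠ n in atTop, 0 < fastDrift p n := by
  filter_upwards [(tendsto_fastDrift_div p).eventually_const_lt (show 0 < p + 2 by linarith),
    eventually_one_lt_log, eventually_gt_atTop 0] with n h hlog hn
  have hn' : (0 : ℝ) < n := by exact_mod_cast hn
  have hl : 0 < Real.log n := by linarith
  exact (div_pos_iff_of_pos_right (by positivity)).1 h

theorem eventually_fastGraph_isAdmissible {c p : ℝ} (hc : 0 < c) (hp : -2 < p) :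
    ∀ᶠ n in atTop, (fastGraph.{u} p n).IsAdmissible c p n ⟨0⟩ {⟨n⟩} := by
  filter_upwards [eventually_fastDrift_pos hp, eventually_one_lt_log, eventually_ge_atTop 2,
    (tendsto_const_div_log 1).eventually_lt_const hc] with n hr hlog hn hc'
  have hn' : (0 : ℝ) < n := by exact_mod_cast (by lia : 0 < n)
  have hl : 0 < Real.log n := by linarith
  refine WeightedGraph.fast_isAdmissible hn ?_
  rw [Real.coe_toNNReal _ (by positivity), Real.coe_toNNReal _ (by positivity)]
  have h1 : (1 + fastDrift p n) ^ (n - 2) ≤ (n : ℝ) ^ (p + 2) / Real.log n ^ 5 := by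
    calc (1 + fastDrift p n) ^ (n - 2) ≤ (1 + fastDrift p n) ^ n :=
          pow_le_pow_right₀ (by linarith) (by lia)
      _ ≤ Real.exp (fastDrift p n) ^ n := by
          gcongr
          linarith [Real.add_one_le_exp (fastDrift p n)]
      _ = (n : ℝ) ^ (p + 2) / Real.log n ^ 5 := by
          rw [← Real.exp_nat_mul, fastDrift, mul_div_cancel₀ _ hn'.ne', Real.exp_sub,
            natCast_rpow_eq_exp (by lia), mul_comm (Real.log n)]
          congr 1
          rw [show 5 * Real.log (Real.log n) = ((5 : ℕ) : ℝ) * Real.log (Real.log n) by norm_num,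
            Real.exp_nat_mul, Real.exp_log hl]
  -- The loop and the last edge each gain `n / log^2 n`. They use up four of the five logarithms in
  -- the drift; the fifth beats the constant `c`.
  calc (1 + fastDrift p n) ^ (n - 2) * (Real.log n ^ 2 / n)
      ≤ (n : ℝ) ^ (p + 2) / Real.log n ^ 5 * (Real.log n ^ 2 / n) := by gcongr
    _ = 1 / Real.log n * (n : ℝ) ^ p * (n / Real.log n ^ 2) := by
        rw [Real.rpow_add hn', show (n : ℝ) ^ (2 : ℝ) = (n : ℝ) ^ 2 by
          rw [← Real.rpow_natCast]; norm_num]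
        field_simp
    _ < c * (n : ℝ) ^ p * (n / Real.log n ^ 2) := by gcongr
    _ ≤ c * (n : ℝ) ^ p * (n / Real.log n ^ 2 + 1) := by gcongr; linarith

/-- The ratio of a bound for the expected hitting time on the fast path to `n ^ 2 / log n`. -/
theorem exists_fastGraph_expectedHit_le {p : ℝ} (hp : -2 < p) :
    ∃ g : ℕ → ℝ, Tendsto g atTop (𝓝 (2 / (p + 2))) ∧ ∀ᶠ n in atTop,
      (fastGraph.{u} p n).expectedHit ⟨0⟩ {⟨n⟩} ≤
        ENNReal.ofReal ((n : ℝ) ^ 2 / Real.log n * g n) := by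
  have hp2 : p + 2 ≠ 0 := by linarith
  set v : ℕ → ℝ := fun n => fastDrift p n / (Real.log n / n) with hv
  have hvt := tendsto_fastDrift_div p
  have hr := tendsto_fastDrift p
  have hL := tendsto_const_div_log 1
  have hinv : Tendsto (fun n : ℕ => 1 / (n : ℝ)) atTop (𝓝 0) := tendsto_one_div_atTop_nhds_zero_nat
  -- Only the second summand survives: it is the travel time `n (ρ + 1)/(ρ - 1)`. The others are the
  -- delays at the loop and at the last edge.
  refine ⟨fun n => (1 + fastDrift p n) / v n * (1 / Real.log n) ^ 2 + (2 + fastDrift p n) / v n +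
    Real.log n / n * (1 / n) + (1 / Real.log n) ^ 3 +
    (2 + 2 * fastDrift p n) / v n * (1 / Real.log n) ^ 2, ?_, ?_⟩
  · have h1 := (((hr.const_add 1).div hvt hp2).mul (hL.pow 2)).add ((hr.const_add 2).div hvt hp2)
    have h2 := (h1.add (tendsto_log_div_natCast.mul hinv)).add (hL.pow 3)
    have h3 := h2.add ((((hr.const_mul 2).const_add 2).div hvt hp2).mul (hL.pow 2))
    have e : (1 + 0) / (p + 2) * 0 ^ 2 + (2 + 0) / (p + 2) + 0 * 0 + 0 ^ 3 +
        (2 + 2 * 0) / (p + 2) * 0 ^ 2 = 2 / (p + 2) := by ring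
    rw [e] at h3
    exact h3
  · filter_upwards [eventually_fastDrift_pos hp, eventually_one_lt_log, eventually_ge_atTop 2]
      with n hr hlog hn
    have hn' : (0 : ℝ) < n := by exact_mod_cast (by lia : 0 < n)
    have hl : 0 < Real.log n := by linarith
    have hρ : 1 < Real.toNNReal (1 + fastDrift p n) := by
      rw [← Real.toNNReal_one]
      exact (Real.toNNReal_lt_toNNReal_iff (by linarith)).2 (by linarith)
    have hη0 : 0 < (1 + fastDrift p n) ^ (n - 2) * (Real.log n ^ 2 / n) := by positivity
    refine (WeightedGraph.fast_expectedHit_le hn hρ (Real.toNNReal_pos.2 hη0)).trans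
      (ENNReal.ofReal_le_ofReal ((WeightedGraph.sum_fastIncr_le hn hρ).trans ?_))
    rw [Real.coe_toNNReal _ (by positivity), Real.coe_toNNReal _ (by positivity),
      Real.coe_toNNReal _ hη0.le, add_sub_cancel_left]
    simp only [hv]
    set r := fastDrift p n
    have hpow : 1 ≤ (1 + r) ^ (n - 2) := one_le_pow₀ (by linarith)
    have h1 : ((n : ℝ) / Real.log n ^ 2 + (1 + r) ^ (n - 2) * ((1 + r + 1) / r + 1)) /
        ((1 + r) ^ (n - 2) * (Real.log n ^ 2 / n)) ≤
        (n / Real.log n ^ 2 + ((1 + r + 1) / r + 1)) / (Real.log n ^ 2 / n) := by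
      rw [← div_div, add_div, mul_div_cancel_left₀ _ (by positivity)]
      have := div_le_self (show 0 ≤ (n : ℝ) / Real.log n ^ 2 by positivity) hpow
      exact div_le_div_of_nonneg_right (by linarith) (by positivity)
    refine (add_le_add_right (add_le_add_right h1 1) _).trans (le_of_eq ?_)
    field_simp
    ring

theorem tendsto_expm1_killRate_div {ℓ : ℝ} (hℓ : 0 < ℓ) :
    Tendsto (fun n : ℕ => (Real.exp (killRate ℓ n) - 1) / (Real.log n / n) ^ 2) atTop (𝓝 ℓ) := by
  have h := (tendsto_expm1_div.comp (tendsto_killRate_ne hℓ)).const_mul ℓ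
  rw [mul_one] at h
  refine h.congr' ?_
  filter_upwards [eventually_one_lt_log, eventually_gt_atTop 0] with n hlog hn
  have hn' : (0 : ℝ) < n := by exact_mod_cast hn
  have hl : 0 < Real.log n := by linarith
  simp only [Function.comp]
  nth_rewrite 2 [killRate]
  field_simp

/-- Lower bound for the Laplace transform of the hitting time on the fast path. -/
theorem eventually_le_fastGraph_laplace {p ℓ σ : ℝ} (hp : -2 < p) (hℓ : 0 < ℓ) (hσ : 0 < σ)
    (h : 2 * ℓ < σ ^ 2 + (p + 2) * σ) :
    ∀ᶠ n : ℕ in atTop, ENNReal.ofReal (1 / 2 * (n : ℝ) ^ (-σ)) ≤ ⨆ N,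
      (fastGraph.{u} p n).laplace {⟨n⟩} (ENNReal.ofReal (Real.exp (-killRate ℓ n))) N ⟨0⟩ := by
  have hL := tendsto_log_div_natCast
  have hM := tendsto_expm1_killRate_div hℓ
  have hr := tendsto_fastDrift p
  have hv := tendsto_fastDrift_div p
  have hden : Tendsto (fun n : ℕ => 1 + σ * (Real.log n / n)) atTop (𝓝 1) := by
    simpa using (hL.const_mul σ).const_add 1
  -- The three subsolution conditions for `s = 1 + σ log n / n`, rescaled. To leading order the
  -- inner one is the hypothesis `h`, that is, `σ` exceeds `√(q^2 + 2ℓ) - q` with `q = (p + 2) / 2`.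
  -- The other two have room because of the logarithms in the loop and in the last edge.
  have hmid : ∀ᶠ n : ℕ in atTop,
      (Real.exp (killRate ℓ n) - 1) / (Real.log n / n) ^ 2 * (2 + fastDrift p n) <
        fastDrift p n / (Real.log n / n) * σ + σ ^ 2 / (1 + σ * (Real.log n / n)) := by
    have h1 := hM.mul (hr.const_add 2)
    have h2 := (hv.mul_const σ).add ((tendsto_const_nhds (x := σ ^ 2)).div hden one_ne_zero)
    refine h1.eventually_lt h2 ?_
    simp only [add_zero, div_one]
    linarith
  have hstart : ∀ᶠ n : ℕ in atTop,
      (Real.exp (killRate ℓ n) - 1) / (Real.log n / n) ^ 2 * (1 / Real.log n + Real.log n / n) <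
        σ := by
    have h1 := hM.mul ((tendsto_const_div_log 1).add hL)
    refine h1.eventually_lt_const ?_
    simpa using hσ
  have hend : ∀ᶠ n : ℕ in atTop,
      (Real.exp (killRate ℓ n) - 1) / (Real.log n / n) ^ 2 * (Real.log n / n) +
        σ / (1 + σ * (Real.log n / n)) < Real.log n * (1 / 2) := by
    have h1 := (hM.mul hL).add ((tendsto_const_nhds (x := σ)).div hden one_ne_zero)
    filter_upwards [h1.eventually_lt_const (show _ < σ + 1 by simp),
      tendsto_log_natCast_atTop.eventually_gt_atTop (2 * (σ + 1))] with n h2 h3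
    simp only [Pi.div_apply] at h2
    linarith
  have hm2 : ∀ᶠ n : ℕ in atTop, Real.exp (killRate ℓ n) < 3 / 2 := by
    have h1 := (Real.continuous_exp.tendsto 0).comp (tendsto_killRate ℓ)
    rw [Real.exp_zero] at h1
    exact h1.eventually_lt_const (by norm_num)
  filter_upwards [hmid, hstart, hend, hm2, eventually_fastDrift_pos hp, eventually_one_lt_log,
    eventually_ge_atTop 2, eventually_killRate_pos hℓ] with n hmid hstart hend hm2 hr hlog hn hk
  have hn' : (0 : ℝ) < n := by exact_mod_cast (by lia : 0 < n)
  have hl : 0 < Real.log n := by linarith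
  have hρ : 1 < Real.toNNReal (1 + fastDrift p n) := by
    rw [← Real.toNNReal_one]
    exact (Real.toNNReal_lt_toNNReal_iff (by linarith)).2 (by linarith)
  set y := σ * (Real.log n / n) with hy
  have hy0 : 0 < y := by positivity
  have hη0 : 0 < (1 + fastDrift p n) ^ (n - 2) * (Real.log n ^ 2 / n) := by positivity
  set r := fastDrift p n
  set M := Real.exp (killRate ℓ n) - 1 with hM'
  have hmM : Real.exp (killRate ℓ n) = M + 1 := by rw [hM']; ring
  set x := Real.log n / n with hx
  have hx0 : 0 < x := by positivity
  have key := WeightedGraph.fast_le_laplace.{u} (K := Real.toNNReal (n / Real.log n ^ 2))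
    (η := Real.toNNReal ((1 + r) ^ (n - 2) * (Real.log n ^ 2 / n))) hn hρ
    (s := 1 + y) (l := killRate ℓ n) (by linarith) hk
    (by
      rw [Real.coe_toNNReal _ (by positivity), hmM]
      have h1 := mul_lt_mul_of_pos_right hmid (pow_pos hx0 2)
      have e1 : M / x ^ 2 * (2 + r) * x ^ 2 = M * (2 + r) := by field_simp
      have e2 : (r / x * σ + σ ^ 2 / (1 + y)) * x ^ 2 = r * y + y ^ 2 / (1 + y) := by
        rw [hy]; field_simp
      rw [e1, e2] at h1
      have e3 : (1 + r) * (1 + y) + (1 + y)⁻¹ - (2 + r) = r * y + y ^ 2 / (1 + y) := by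
        field_simp; ring
      linarith)
    (by
      rw [Real.coe_toNNReal _ (by positivity), hmM]
      have h1 := mul_lt_mul_of_pos_right hstart hx0
      have e1 : M / x ^ 2 * (1 / Real.log n + x) * x = M * (n / Real.log n ^ 2 + 1) := by
        rw [hx]; field_simp
      rw [e1] at h1
      linarith)
    (by
      rw [Real.coe_toNNReal _ (by positivity), Real.coe_toNNReal _ hη0.le, hmM]
      set κ := Real.log n ^ 2 / n with hκ
      have hκ0 : 0 < κ := by positivity
      have h1 := mul_lt_mul_of_pos_right hend hx0
      have e1 : (M / x ^ 2 * x + σ / (1 + y)) * x = M + (1 - (1 + y)⁻¹) := by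
        rw [hy]; field_simp; ring
      have e2 : Real.log n * (1 / 2) * x = κ * (1 / 2) := by rw [hκ, hx]; ring
      rw [e1, e2] at h1
      have hM2 : M < 1 / 2 := by linarith
      have h2 : (M + 1) * (1 + κ) ≤ (1 + y)⁻¹ + 2 * κ := by nlinarith
      have hpow : 0 < (1 + r) ^ (n - 2) := by positivity
      have h3 := mul_le_mul_of_nonneg_left h2 hpow.le
      linarith)
  refine le_trans (ENNReal.ofReal_le_ofReal ?_) key
  gcongr
  rw [Real.rpow_neg hn'.le]
  apply inv_anti₀ (by positivity)
  calc (1 + y) ^ (n - 1) ≤ (1 + y) ^ n := pow_le_pow_right₀ (by linarith) (by lia)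
    _ ≤ Real.exp y ^ n := by
        gcongr
        linarith [Real.add_one_le_exp y]
    _ = (n : ℝ) ^ σ := by
        rw [← Real.exp_nat_mul, natCast_rpow_eq_exp (by lia), hy, hx]
        congr 1
        field_simp

theorem exp_killRate_mul (ℓ α : ℝ) {n : ℕ} (hn : 0 < n) (hlog : 0 < Real.log n) :
    Real.exp (killRate ℓ n * (α * (n : ℝ) ^ 2 / Real.log n)) = (n : ℝ) ^ (ℓ * α) := by
  have hn' : (0 : ℝ) < n := by exact_mod_cast hn
  rw [natCast_rpow_eq_exp hn, killRate]
  congr 1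
  field_simp

/-! ### The lower bound for the large deviations. -/

/-- Two strict inequalities between chords and tangents of the square root. -/
theorem exists_chord_gap {ℓ x α α' : ℝ} (hℓ : 0 < ℓ) (hx : 0 < x) (hα' : 0 < α')
    (h1 : α' * x < 1) (h2 : 1 < α * x) :
    ∃ ϑ, 0 < ϑ ∧ ϑ < ℓ ∧ x + ϑ * α' < Real.sqrt (x ^ 2 + 2 * ϑ) ∧
      x - ϑ * α < Real.sqrt (x ^ 2 - 2 * ϑ) := by
  have hα : 0 < α := by
    by_contra! h
    nlinarith
  have hg1 : 0 < (1 - α' * x) / α' ^ 2 := by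
    have : 0 < 1 - α' * x := by linarith
    positivity
  have hg2 : 0 < (α * x - 1) / α ^ 2 := by
    have : 0 < α * x - 1 := by linarith
    positivity
  -- After squaring, the claims read `ϑ α'^2 < 2 (1 - α' x)` and `ϑ α^2 < 2 (α x - 1)`; the choice
  -- leaves a factor 2.
  set ϑ := min (ℓ / 2) (min ((1 - α' * x) / α' ^ 2) ((α * x - 1) / α ^ 2)) with hϑ
  have hϑ0 : 0 < ϑ := lt_min (by linarith) (lt_min hg1 hg2)
  have hϑℓ : ϑ ≤ ℓ / 2 := min_le_left _ _
  have hϑ1 : ϑ * α' ^ 2 ≤ 1 - α' * x :=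
    (le_div_iff₀ (by positivity)).1 ((min_le_right _ _).trans (min_le_left _ _))
  have hϑ2 : ϑ * α ^ 2 ≤ α * x - 1 :=
    (le_div_iff₀ (by positivity)).1 ((min_le_right _ _).trans (min_le_right _ _))
  refine ⟨ϑ, hϑ0, by linarith, ?_, ?_⟩
  · apply Real.lt_sqrt_of_sq_lt
    have := mul_le_mul_of_nonneg_left hϑ1 hϑ0.le
    nlinarith
  · apply Real.lt_sqrt_of_sq_lt
    have := mul_le_mul_of_nonneg_left hϑ2 hϑ0.le
    nlinarith

theorem sq_le_half_sub_cube {y : ℝ} (h0 : 0 ≤ y) (h1 : y ≤ 1 / 4) :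
    y ^ 2 ≤ 1 / 2 * y - 2 * y ^ 3 := by
  have h2 : y ^ 2 ≤ 1 / 4 * (1 / 4) := by rw [sq]; gcongr
  have : 0 ≤ y * (1 / 2 - 2 * y ^ 2 - y) := mul_nonneg h0 (by linarith)
  linarith

/-- The parameter `ℓ` is tuned so that `√(q^2 + 2ℓ) = 1 / β`, whose derivative in `ℓ` is `β`: the
tilted hitting time concentrates near `β n^2 / log n`, so between the scales `α'` and `α`. The
universal bound at `ℓ ± ϑ` makes the two tails negligible. -/
theorem eventually_le_fastGraph_probHitBefore {c p α β α' δ : ℝ} (hc : 0 < c) (hp : -2 < p)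
    (hα' : 0 < α') (hαβ : α' < β) (hβα : β < α) (hα : α < 2 / (p + 2)) (hδ : 0 < δ) :
    ∀ᶠ n : ℕ in atTop, ENNReal.ofReal ((n : ℝ) ^
        (((1 / β) ^ 2 - ((p + 2) / 2) ^ 2) / 2 * α' - (1 / β - (p + 2) / 2) - δ)) ≤
      (fastGraph.{u} p n).probHitBefore ⟨0⟩ {⟨n⟩} (α * (n : ℝ) ^ 2 / Real.log n) := by
  have hp2 : 0 < p + 2 := by linarith
  have hβ0 : 0 < β := hα'.trans hαβ
  set q := (p + 2) / 2 with hq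
  set x := 1 / β with hx
  have hx0 : 0 < x := by positivity
  have hqx : q < x := by
    rw [hx, lt_div_iff₀ hβ0, hq]
    rw [lt_div_iff₀ hp2] at hα
    nlinarith
  have hq0 : 0 < q := by positivity
  set ℓ := (x ^ 2 - q ^ 2) / 2 with hℓ
  have hℓ0 : 0 < ℓ := by
    have : q ^ 2 < x ^ 2 := by gcongr
    rw [hℓ]; linarith
  obtain ⟨ϑ, hϑ0, hϑℓ, hgap1, hgap2⟩ := exists_chord_gap (α := α) hℓ0 hx0 hα'
    (by rw [hx, mul_one_div, div_lt_one hβ0]; exact hαβ)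
    (by rw [hx, mul_one_div, one_lt_div hβ0]; exact hβα)
  set g := min δ (min (Real.sqrt (x ^ 2 + 2 * ϑ) - (x + ϑ * α'))
    (Real.sqrt (x ^ 2 - 2 * ϑ) - (x - ϑ * α))) with hg
  have hg0 : 0 < g := lt_min hδ (lt_min (by linarith) (by linarith))
  have hgδ : g ≤ δ := min_le_left _ _
  have hg1 : g ≤ Real.sqrt (x ^ 2 + 2 * ϑ) - (x + ϑ * α') :=
    (min_le_right _ _).trans (min_le_left _ _)
  have hg2 : g ≤ Real.sqrt (x ^ 2 - 2 * ϑ) - (x - ϑ * α) :=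
    (min_le_right _ _).trans (min_le_right _ _)
  have hY : Tendsto (fun n : ℕ => (n : ℝ) ^ (-(g / 4))) atTop (𝓝 0) :=
    (tendsto_rpow_neg_atTop (by positivity)).comp tendsto_natCast_atTop_atTop
  -- At `σ = x - q` the required inequality is an equality. The excess `g / 4` costs one factor `Y =
  -- n^(-g/4)` in the main term, against `Y^3` in each tail, where the gap `g` loses only `g / 4`.
  have hlow := eventually_le_fastGraph_laplace.{u} (σ := x - q + g / 4) hp hℓ0 (by linarith) (by
    have : 2 * ℓ = (x - q) ^ 2 + (p + 2) * (x - q) := by rw [hℓ, hq]; ring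
    rw [this]
    nlinarith)
  filter_upwards [hlow, eventually_laplace_le.{u} (p := p) hc (show 0 < ℓ + ϑ by linarith)
    (show 0 < g / 4 by linarith), eventually_laplace_le.{u} (p := p) hc
    (show 0 < ℓ - ϑ by linarith) (show 0 < g / 4 by linarith),
    eventually_fastGraph_isAdmissible.{u} hc hp, eventually_one_lt_log, eventually_gt_atTop 0,
    hY.eventually_lt_const (show (0 : ℝ) < 1 / 4 by norm_num), eventually_killRate_pos hℓ0,
    eventually_killRate_pos hϑ0]
    with n hlow hup1 hup2 hadm hlog hn hYn hkℓ hkϑ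
  have hn' : (0 : ℝ) < n := by exact_mod_cast hn
  have hl : 0 < Real.log n := by linarith
  set P := (fastGraph.{u} p n).probHitBefore ⟨0⟩ {⟨n⟩} (α * (n : ℝ) ^ 2 / Real.log n) with hP
  have hPtop : P ≠ ⊤ := by
    rw [hP, WeightedGraph.probHitBefore]; exact measure_ne_top _ _
  have hkadd : killRate (ℓ + ϑ) n = killRate ℓ n + killRate ϑ n := by simp only [killRate]; ring
  have hksub : killRate (ℓ - ϑ) n = killRate ℓ n - killRate ϑ n := by simp only [killRate]; ring
  have hsum : ENNReal.ofReal (1 / 2 * (n : ℝ) ^ (-(x - q + g / 4))) ≤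
      ENNReal.ofReal ((n : ℝ) ^ (-(x - q) - 3 * g / 4)) +
        ENNReal.ofReal ((n : ℝ) ^ (-(ℓ * α'))) * P +
        ENNReal.ofReal ((n : ℝ) ^ (-(x - q) - 3 * g / 4)) := by
    refine hlow.trans (iSup_le fun N => ?_)
    refine (WeightedGraph.laplace_le_three _ (hadm.notMem hn) (ϑ := killRate ϑ n)
      (s := α' * (n : ℝ) ^ 2 / Real.log n) (t := α * (n : ℝ) ^ 2 / Real.log n) hkℓ.le hkϑ.le
      N).trans ?_
    rw [← hkadd, ← hksub, ← hP, exp_killRate_mul ϑ α' hn hl, neg_mul, neg_mul,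
      Real.exp_neg (killRate ℓ n * _), Real.exp_neg (killRate ϑ n * _), exp_killRate_mul ℓ α' hn hl, exp_killRate_mul ϑ α hn hl,
      ← Real.rpow_neg hn'.le, ← Real.rpow_neg hn'.le]
    have hn1 : (1 : ℝ) ≤ n := by exact_mod_cast hn
    gcongr
    · refine (mul_le_mul_right (hup1 _ _ _ _ hadm N) _).trans ?_
      rw [← ENNReal.ofReal_mul (by positivity), ← Real.rpow_add hn']
      apply ENNReal.ofReal_le_ofReal
      apply Real.rpow_le_rpow_of_exponent_le hn1
      rw [show q ^ 2 + 2 * (ℓ + ϑ) = x ^ 2 + 2 * ϑ by rw [hℓ]; ring]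
      linarith
    · refine (mul_le_mul_right (hup2 _ _ _ _ hadm N) _).trans ?_
      rw [← ENNReal.ofReal_mul (by positivity), ← Real.rpow_add hn']
      apply ENNReal.ofReal_le_ofReal
      apply Real.rpow_le_rpow_of_exponent_le hn1
      rw [show q ^ 2 + 2 * (ℓ - ϑ) = x ^ 2 - 2 * ϑ by rw [hℓ]; ring]
      linarith
  rw [← ENNReal.ofReal_toReal hPtop] at hsum ⊢
  have hP0 : 0 ≤ P.toReal := ENNReal.toReal_nonneg
  rw [← ENNReal.ofReal_mul (by positivity), ← ENNReal.ofReal_add (by positivity) (by positivity),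
    ← ENNReal.ofReal_add (by positivity) (by positivity),
    ENNReal.ofReal_le_ofReal_iff (by positivity)] at hsum
  apply ENNReal.ofReal_le_ofReal
  set Y := (n : ℝ) ^ (-(g / 4)) with hYdef
  have hY0 : 0 < Y := by positivity
  set Z := (n : ℝ) ^ (-(x - q)) with hZ
  have hZ0 : 0 < Z := by positivity
  set A := (n : ℝ) ^ (ℓ * α') with hA
  have hA0 : 0 < A := by positivity
  have e1 : (n : ℝ) ^ (-(x - q + g / 4)) = Z * Y := by
    rw [hZ, hYdef, ← Real.rpow_add hn']; congr 1; ring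
  have e2 : (n : ℝ) ^ (-(x - q) - 3 * g / 4) = Z * Y ^ 3 := by
    rw [hZ, hYdef, ← Real.rpow_natCast, ← Real.rpow_mul hn'.le, ← Real.rpow_add hn']
    congr 1; push_cast; ring
  have e3 : (n : ℝ) ^ (-(ℓ * α')) = A⁻¹ := by rw [hA, Real.rpow_neg hn'.le]
  rw [e1, e2, e3] at hsum
  -- Since `Y ≤ 1 / 4`, the main term `Z Y / 2` exceeds the two tails `Z Y^3` by at least `Z Y^2`.
  have h1 : Z * Y ^ 2 ≤ A⁻¹ * P.toReal := by
    have h2 := mul_le_mul_of_nonneg_left (sq_le_half_sub_cube hY0.le hYn.le) hZ0.le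
    linarith
  rw [le_inv_mul_iff₀ hA0] at h1
  refine le_trans ?_ h1
  rw [hA, hZ, hYdef, ← Real.rpow_natCast, ← Real.rpow_mul hn'.le, ← Real.rpow_add hn',
    ← Real.rpow_add hn']
  apply Real.rpow_le_rpow_of_exponent_le (by exact_mod_cast hn)
  push_cast
  linarith

theorem eventually_le_supProbHit {c p α ε : ℝ} (hc : 0 < c) (hp : -2 < p) (hα : 0 < α)
    (hα' : α < 2 / (p + 2)) (hε : 0 < ε) :
    ∀ᶠ n : ℕ in atTop, ENNReal.ofReal ((n : ℝ) ^ (-(α * (p + 2) - 2) ^ 2 / (8 * α) - ε)) ≤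
      supProbHit.{u} c p n (α * (n : ℝ) ^ 2 / Real.log n) := by
  -- The exponent for `β = α - t` and `α' = α - 2t`; it is continuous at `t = 0`, where it takes the
  -- desired value.
  let F : ℝ → ℝ := fun t => ((1 / (α - t)) ^ 2 - ((p + 2) / 2) ^ 2) / 2 * (α - 2 * t) -
    (1 / (α - t) - (p + 2) / 2)
  have hF0 : F 0 = -(α * (p + 2) - 2) ^ 2 / (8 * α) := by
    simp only [F, sub_zero, mul_zero]; field_simp; ring
  have hcont : ContinuousAt F 0 := by
    have h1 : ContinuousAt (fun t : ℝ => 1 / (α - t)) 0 :=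
      continuousAt_const.div (by fun_prop) (by simpa using hα.ne')
    exact (((h1.pow 2).sub continuousAt_const).div_const 2 |>.mul (by fun_prop)).sub
      (h1.sub continuousAt_const)
  have hev : ∀ᶠ t in 𝓝[>] (0 : ℝ), F 0 - ε / 2 < F t ∧ t < α / 2 ∧ 0 < t := by
    have h1 := hcont.eventually_const_lt (show F 0 - ε / 2 < F 0 by linarith)
    have h2 := eventually_lt_nhds (show (0 : ℝ) < α / 2 by linarith)
    filter_upwards [h1.filter_mono nhdsWithin_le_nhds, h2.filter_mono nhdsWithin_le_nhds,
      self_mem_nhdsWithin] with t h1 h2 h3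
    exact ⟨h1, h2, h3⟩
  obtain ⟨t, ht1, ht2, ht3⟩ := hev.exists
  filter_upwards [eventually_le_fastGraph_probHitBefore.{u} (α := α) (β := α - t)
    (α' := α - 2 * t) hc hp (by linarith) (by linarith) (by linarith) hα' (half_pos hε),
    eventually_fastGraph_isAdmissible.{u} hc hp, eventually_gt_atTop 0] with n h hadm hn
  have hn1 : (1 : ℝ) ≤ n := by exact_mod_cast hn
  refine le_trans ?_ (h.trans ?_)
  · apply ENNReal.ofReal_le_ofReal
    apply Real.rpow_le_rpow_of_exponent_le hn1
    rw [← hF0]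
    change _ ≤ F t - ε / 2
    linarith
  · refine le_iSup_of_le (ULift.{u} ℕ) (le_iSup_of_le _ (le_iSup_of_le inferInstance ?_))
    exact le_iSup_of_le (fastGraph p n) (le_iSup_of_le ⟨0⟩ (le_iSup_of_le ⟨n⟩
      (le_iSup_of_le hadm le_rfl)))

theorem supProbHit_le_supProbHitSet (c p : ℝ) (n : ℕ) (t : ℝ) :
    supProbHit.{u} c p n t ≤ supProbHitSet.{u} c p n t := by
  simp only [supProbHit, iSup_le_iff]
  intro V i₁ i₂ G o z hadm
  exact le_iSup_of_le V (le_iSup_of_le i₁ (le_iSup_of_le i₂ (le_iSup_of_le G (le_iSup_of_le o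
    (le_iSup_of_le {z} (le_iSup_of_le hadm le_rfl))))))

theorem infExpectedHitSet_le_infExpectedHit (c p : ℝ) (n : ℕ) :
    infExpectedHitSet.{u} c p n ≤ infExpectedHit.{u} c p n := by
  simp only [infExpectedHit, le_iInf_iff]
  intro V i₁ i₂ G o z hadm
  exact iInf_le_of_le V (iInf_le_of_le i₁ (iInf_le_of_le i₂ (iInf_le_of_le G (iInf_le_of_le o
    (iInf_le_of_le {z} (iInf_le_of_le hadm le_rfl))))))

theorem exists_infExpectedHit_le {c p : ℝ} (hc : 0 < c) (hp : -2 < p) :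
    ∃ g : ℕ → ℝ, Tendsto g atTop (𝓝 (2 / (p + 2))) ∧ ∀ᶠ n : ℕ in atTop,
      infExpectedHit.{u} c p n ≤ ENNReal.ofReal ((n : ℝ) ^ 2 / Real.log n * g n) := by
  obtain ⟨g, hg, h⟩ := exists_fastGraph_expectedHit_le.{u} hp
  refine ⟨g, hg, ?_⟩
  filter_upwards [h, eventually_fastGraph_isAdmissible.{u} hc hp] with n h hadm
  exact iInf_le_of_le (ULift.{u} ℕ) (iInf_le_of_le _ (iInf_le_of_le inferInstance
    (iInf_le_of_le (fastGraph p n) (iInf_le_of_le ⟨0⟩ (iInf_le_of_le ⟨n⟩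
      (iInf_le_of_le hadm h))))))

/-! ### From two-sided bounds to the asymptotic statements. -/

theorem exists_exponent {S : ℕ → ℝ≥0∞} {a : ℝ}
    (hup : ∀ ε > 0, ∀ᶠ n : ℕ in atTop, S n ≤ ENNReal.ofReal ((n : ℝ) ^ (a + ε)))
    (hlow : ∀ ε > 0, ∀ᶠ n : ℕ in atTop, ENNReal.ofReal ((n : ℝ) ^ (a - ε)) ≤ S n) :
    ∃ ε : ℕ → ℝ, Tendsto ε atTop (𝓝 0) ∧
      ∀ᶠ n : ℕ in atTop, S n = ENNReal.ofReal ((n : ℝ) ^ (a + ε n)) := by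
  have hbasic : ∀ ε > 0, ∀ᶠ n : ℕ in atTop, 0 < (S n).toReal ∧ S n ≠ ⊤ ∧
      (a - ε) * Real.log n ≤ Real.log (S n).toReal ∧
      Real.log (S n).toReal ≤ (a + ε) * Real.log n := by
    intro ε hε
    filter_upwards [hup ε hε, hlow ε hε, eventually_gt_atTop 0] with n h1 h2 hn
    have hn' : (0 : ℝ) < n := by exact_mod_cast hn
    have htop : S n ≠ ⊤ := ne_top_of_le_ne_top ENNReal.ofReal_ne_top h1
    rw [← ENNReal.ofReal_toReal htop] at h1 h2
    rw [ENNReal.ofReal_le_ofReal_iff (by positivity)] at h1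
    rw [ENNReal.ofReal_le_ofReal_iff ENNReal.toReal_nonneg] at h2
    have hpos : 0 < (S n).toReal := lt_of_lt_of_le (by positivity) h2
    refine ⟨hpos, htop, ?_, ?_⟩
    · rw [← Real.log_rpow hn']
      exact Real.log_le_log (by positivity) h2
    · rw [← Real.log_rpow hn']
      exact Real.log_le_log hpos h1
  refine ⟨fun n => Real.log (S n).toReal / Real.log n - a, ?_, ?_⟩
  · rw [Metric.tendsto_atTop']
    intro ε hε
    have := (hbasic (ε / 2) (half_pos hε)).and eventually_one_lt_log
    obtain ⟨N, hN⟩ := eventually_atTop.1 this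
    refine ⟨N, fun n hn => ?_⟩
    obtain ⟨⟨-, -, h1, h2⟩, hlog⟩ := hN n hn.le
    have hl : 0 < Real.log n := by linarith
    rw [← le_div_iff₀ hl] at h1
    rw [← div_le_iff₀ hl] at h2
    rw [Real.dist_eq, sub_zero, abs_lt]
    constructor <;> linarith
  · filter_upwards [hbasic 1 one_pos, eventually_one_lt_log, eventually_gt_atTop 0]
      with n h hlog hn
    have hl : 0 < Real.log n := by linarith
    rw [add_sub_cancel, natCast_rpow_eq_exp hn, mul_div_cancel₀ _ hl.ne', Real.exp_log h.1,
      ENNReal.ofReal_toReal h.2.1]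

theorem isEquivalent_of_bounds {I : ℕ → ℝ≥0∞} {p : ℝ} (hp : -2 < p) {g : ℕ → ℝ}
    (hg : Tendsto g atTop (𝓝 (2 / (p + 2))))
    (hup : ∀ᶠ n : ℕ in atTop, I n ≤ ENNReal.ofReal ((n : ℝ) ^ 2 / Real.log n * g n))
    (hlow : ∀ α δ : ℝ, 0 < α → α < 2 / (p + 2) → 0 < δ → ∀ᶠ n : ℕ in atTop,
      ENNReal.ofReal (α * (n : ℝ) ^ 2 / Real.log n * (1 - δ)) ≤ I n) :
    (fun n : ℕ => (I n).toReal) ~[atTop]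
      fun n : ℕ => 2 * (n : ℝ) ^ 2 / ((p + 2) * Real.log n) := by
  have hp2 : 0 < p + 2 := by linarith
  have hA0 : 0 < 2 / (p + 2) := by positivity
  set A := 2 / (p + 2) with hA
  have htend : Tendsto (fun n : ℕ => (I n).toReal / ((n : ℝ) ^ 2 / Real.log n)) atTop (𝓝 A) := by
    refine tendsto_order.2 ⟨fun a ha => ?_, fun a ha => ?_⟩
    -- A point below `A`, above `a` and positive even for negative `a`; `δ` is chosen so that `α (1
    -- - δ) = (α + a) / 2 > a`.
    · set α := max ((a + A) / 2) (A / 2) with hα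
      have hα0 : 0 < α := lt_max_of_lt_right (by linarith)
      have hαA : α < A := max_lt (by linarith) (by linarith)
      have haα : a < α := lt_max_of_lt_left (by linarith)
      have hδ : 0 < (α - a) / (2 * α) := div_pos (by linarith) (by linarith)
      filter_upwards [hlow α _ hα0 hαA hδ, hup, eventually_one_lt_log, eventually_gt_atTop 0]
        with n h1 h2 hlog hn
      have hn' : (0 : ℝ) < n := by exact_mod_cast hn
      have hl : 0 < Real.log n := by linarith
      -- The upper bound gives finiteness, so that `toReal` loses nothing.
      have htop : I n ≠ ⊤ := ne_top_of_le_ne_top ENNReal.ofReal_ne_top h2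
      have h3 := (ENNReal.ofReal_le_iff_le_toReal htop).1 h1
      rw [lt_div_iff₀ (by positivity)]
      refine lt_of_lt_of_le ?_ h3
      have e : α * (n : ℝ) ^ 2 / Real.log n * (1 - (α - a) / (2 * α)) =
          (α + a) / 2 * ((n : ℝ) ^ 2 / Real.log n) := by field_simp; ring
      rw [e]
      have : 0 < (n : ℝ) ^ 2 / Real.log n := by positivity
      gcongr
      linarith
    · filter_upwards [hup, hg.eventually_lt_const ha, hg.eventually_const_lt hA0,
        eventually_one_lt_log, eventually_gt_atTop 0] with n h2 h3 h4 hlog hn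
      have hn' : (0 : ℝ) < n := by exact_mod_cast hn
      have hl : 0 < Real.log n := by linarith
      have hb : 0 < (n : ℝ) ^ 2 / Real.log n := by positivity
      rw [div_lt_iff₀ hb]
      have h5 := ENNReal.toReal_mono ENNReal.ofReal_ne_top h2
      rw [ENNReal.toReal_ofReal (by positivity)] at h5
      refine h5.trans_lt ?_
      rw [mul_comm]
      gcongr
  rw [isEquivalent_iff_tendsto_one]
  · have h := htend.div_const A
    rw [div_self hA0.ne'] at h
    refine h.congr' ?_
    filter_upwards [eventually_one_lt_log, eventually_gt_atTop 0] with n hlog hn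
    have hn' : (0 : ℝ) < n := by exact_mod_cast hn
    have hl : 0 < Real.log n := by linarith
    simp only [Pi.div_apply, hA]
    field_simp
  · filter_upwards [eventually_one_lt_log, eventually_gt_atTop 0] with n hlog hn
    have hn' : (0 : ℝ) < n := by exact_mod_cast hn
    have hl : 0 < Real.log n := by linarith
    positivity

theorem theorem5 (c p : ℝ) (hc : 0 < c) (hp : -2 < p) :
    -- the expected hitting time, for a target vertex and for a target set
    ((fun n : ℕ => (infExpectedHit.{u} c p n).toReal) ~[atTop]
        fun n : ℕ => 2 * (n : ℝ) ^ 2 / ((p + 2) * Real.log n)) ∧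
    ((fun n : ℕ => (infExpectedHitSet.{u} c p n).toReal) ~[atTop]
        fun n : ℕ => 2 * (n : ℝ) ^ 2 / ((p + 2) * Real.log n)) ∧
    -- the large deviations, for a target vertex and for a target set
    ∀ α : ℝ, 0 < α → α < 2 / (p + 2) →
      (∃ ε : ℕ → ℝ, Tendsto ε atTop (𝓝 0) ∧ ∀ᶠ n : ℕ in atTop,
        supProbHit.{u} c p n (α * (n : ℝ) ^ 2 / Real.log n) =
          ENNReal.ofReal ((n : ℝ) ^ (-(α * (p + 2) - 2) ^ 2 / (8 * α) + ε n))) ∧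
      (∃ ε : ℕ → ℝ, Tendsto ε atTop (𝓝 0) ∧ ∀ᶠ n : ℕ in atTop,
        supProbHitSet.{u} c p n (α * (n : ℝ) ^ 2 / Real.log n) =
          ENNReal.ofReal ((n : ℝ) ^ (-(α * (p + 2) - 2) ^ 2 / (8 * α) + ε n))) := by
  -- A single vertex is a special set, so the universal bounds for sets and the fast path with a
  -- target vertex together settle both versions.
  obtain ⟨g, hg, hup⟩ := exists_infExpectedHit_le.{u} hc hp
  have hlow := fun (α δ : ℝ) (hα : 0 < α) (hα' : α < 2 / (p + 2)) (hδ : 0 < δ) =>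
    eventually_le_infExpectedHitSet.{u} hc hp hα hα' hδ
  refine ⟨isEquivalent_of_bounds hp hg hup fun α δ hα hα' hδ => ?_,
    isEquivalent_of_bounds hp hg ?_ hlow, fun α hα hα' => ⟨?_, ?_⟩⟩
  · exact (hlow α δ hα hα' hδ).mono fun n h => h.trans (infExpectedHitSet_le_infExpectedHit c p n)
  · exact hup.mono fun n h => (infExpectedHitSet_le_infExpectedHit c p n).trans h
  · exact exists_exponent
      (fun ε hε => (eventually_supProbHitSet_le hc hp hα hα' hε).mono fun n h =>
        (supProbHit_le_supProbHitSet c p n _).trans h)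
      (fun ε hε => eventually_le_supProbHit hc hp hα hα' hε)
  · exact exists_exponent
      (fun ε hε => eventually_supProbHitSet_le hc hp hα hα' hε)
      (fun ε hε => (eventually_le_supProbHit hc hp hα hα' hε).mono fun n h =>
        h.trans (supProbHit_le_supProbHitSet c p n _))
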